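/- **Setting.** Let $(X,d)$ be a Gromov hyperbolic metric space (not necessarily geodesic or proper), i.e. with $\langle x|y\rangle_z=\frac12[d(x,z)+d(y,z)-d(x,y)]$ there is a constant $c$ such that $\langle x|z\rangle_w\ge\min(\langle x|y\rangle_w,\langle y|z\rangle_w)-c$ for all $x,y,z,w\in X$. Fix $o\in X$. Let $\partial X$ be the Gromov boundary: sequences in $X$ with $\langle x_n|x_m\rangle_o\to\infty$ as $n,m\to\infty$, modulo $x\sim y$ iff $\langle x_n|y_n\rangle_o\to\infty$. Isometries of $X$ act on $\partial X$. For $\xi,\eta\in\partial X$ and $y,z\in X$ put $\langle\xi|\eta\rangle_z=\inf\liminf_{n,m}\langle x_n|y_m\rangle_z$, the infimum over $(x_n)\in\xi$, $(y_m)\in\eta$, and $\langle y|\xi\rangle_z=\inf\liminf_n\langle x_n|y\rangle_z$, the infimum over $(x_n)\in\xi$. Let $b>1$ be such that there is a visual metric $D$ on $\partial X$, i.e. a metric with $D(\xi,\eta)\asymp b^{-\langle\xi|\eta\rangle_o}$ up to a multiplicative constant, and fix such a $D$; $\mathrm{HD}$ denotes Hausdorff dimension with respect to $D$. An isometry $g$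 is loxodromic if it has two distinct fixed points $g_+,g_-\in\partial X$ such that $g^n\to g_+$ uniformly on $\partial X\setminus U$ for every neighbourhood $U$ of $g_-$, and $g^{-n}\to g_-$ uniformly on $\partial X\setminus U$ for every neighbourhood $U$ of $g_+$. Let $G$ be a group of isometries (bijective) of $X$ which is strongly discrete, i.e. $\{g\in G: d(o,g(o))\le r\}$ is finite for every $r>0$, and of general type, i.e. $G$ contains two loxodromic isometries $g_1,g_2$ with $\{g_{1,+},g_{1,-}\}\cap\{g_{2,+},g_{2,-}\}=\emptyset$. Let $$\delta=\inf\Big\{s\ge0:\sum_{g\in G}b^{-s\,d(o,g(o))}<\infty\Big\}\in[0,\infty],\qquad \inf\emptyset=+\infty .$$ The radial limit set $\Lambda_r$ is the set of $\eta\in\partial X$ for which there are $\sigma>0$ and a sequence $(g_n)_{n\ge1}$ in $G$ with $\langle g_n(o)|\eta\rangle_o\to\infty$ and $\langle o|\eta\rangle_{g_n(o)}\le\sigma$ for all $n$. The uniformly radial limit set $\Lambda_{ur}$ is the set of $\eta$ for which $\sigma$ and $(g_n)$ can be chosen such that in addition $g_1(o)=o$ and $d(g_n(o),g_{n+1}(o))\le\sigma$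 for all $n$. For $\xi\in\partial X$, let $\mathrm{BA}_\xi$ be the set of $\eta\in\Lambda_r$ for which there is $\varepsilon>0$ with $D(g(\xi),\eta)\ge\varepsilon\, b^{-d(o,g(o))}$ for all $g\in G$. **Theorem.** For every countable (finite or infinite) family $(\xi_k)_k$ of points of $\partial X$, $$\mathrm{HD}\Big(\bigcap_k\mathrm{BA}_{\xi_k}\cap\Lambda_{ur}\Big)=\delta=\mathrm{HD}(\Lambda_r).$$ In particular $\mathrm{BA}_\xi\ne\emptyset$ for every $\xi\in\partial X$, so the generalized Dirichlet theorem (for $\eta\in\Lambda_r$ there is $C>0$ with $D(g(\xi),\eta)\le C\,b^{-d(o,g(o))}$ for infinitely many $g\in G$) is optimal: for every $\xi\in\partial X$ there is no function $\varphi:\mathbb R\to\mathbb R$ with $\varphi(t)\to0$ as $t\to+\infty$ such that for every $\eta\in\Lambda_r$ there is a constant $C=C_\eta>0$ with $$D(g(\xi),\eta)\le C\,b^{-d(o,g(o))}\,\varphi\big(b^{d(o,g(o))}\big)\quad\text{for infinitely many }g\in G.$$ -/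

import Mathlib

open Filter Topology
open scoped NNReal ENNReal

noncomputable section

namespace HypDioph

/-- The Gromov product `⟨x|y⟩_z` of two points of a metric space. -/
def gromovProd {X : Type*} [MetricSpace X] (z x y : X) : ℝ :=
  (dist x z + dist y z - dist x y) / 2

/-- A metric space is Gromov hyperbolic if Gromov's inequality
`⟨x|z⟩_w ≥ min ⟨x|y⟩_w ⟨y|z⟩_w - C` holds with a constant `C` depending only on the space.
The space is not assumed to be geodesic or proper. -/
class GromovHyperbolic (X : Type*) [MetricSpace X] : Prop where
  gromov_ineq : ∃ C : ℝ, ∀ x y z w : X,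
    min (gromovProd w x y) (gromovProd w y z) - C ≤ gromovProd w x z

/-- `(x_n)` is a Gromov sequence: `⟨x_n|x_m⟩_o → +∞` as `n, m → ∞`. -/
def IsGromovSeq {X : Type*} [MetricSpace X] (o : X) (x : ℕ → X) : Prop :=
  Tendsto (fun p : ℕ × ℕ => gromovProd o (x p.1) (x p.2)) atTop atTop

/-- The type of Gromov sequences. -/
def GromovSeq {X : Type*} [MetricSpace X] (o : X) : Type _ :=
  {x : ℕ → X // IsGromovSeq o x}

theorem gromovProd_comm {X : Type*} [MetricSpace X] (z x y : X) :
    gromovProd z x y = gromovProd z y x := by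
  simp only [gromovProd, dist_comm x y]; ring

theorem gromovProd_map {X : Type*} [MetricSpace X] (g : X ≃ᵢ X) (o x y : X) :
    gromovProd o x y - dist o (g o) ≤ gromovProd o (g x) (g y) := by
  have h1 : dist x o ≤ dist (g x) o + dist o (g o) := by
    rw [← g.dist_eq x o]; exact dist_triangle _ _ _
  have h2 : dist y o ≤ dist (g y) o + dist o (g o) := by
    rw [← g.dist_eq y o]; exact dist_triangle _ _ _
  simp only [gromovProd, g.dist_eq]
  linarith

/-- Gromov sequences `x, y` are equivalent if `⟨x_n|y_n⟩_o → +∞`. -/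
def gromovSetoid {X : Type*} [MetricSpace X] [GromovHyperbolic X] (o : X) :
    Setoid (GromovSeq o) where
  r x y := Tendsto (fun n => gromovProd o (x.1 n) (y.1 n)) atTop atTop
  iseqv :=
    { refl := fun x => x.2.comp (tendsto_atTop_diagonal)
      symm := fun {x y} h => by simpa only [gromovProd_comm] using h
      trans := fun {x y z} h1 h2 => by
        obtain ⟨C, hC⟩ := GromovHyperbolic.gromov_ineq (X := X)
        refine tendsto_atTop_mono (fun n => hC (x.1 n) (y.1 n) (z.1 n) o) ?_
        exact tendsto_atTop_add_const_right _ (-C) (tendsto_atTop.2 fun c => by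
          filter_upwards [h1.eventually_ge_atTop c, h2.eventually_ge_atTop c] with n a b
          exact le_min a b) }

/-- The Gromov boundary `∂X`: Gromov sequences modulo equivalence. -/
def GromovBoundary {X : Type*} [MetricSpace X] [GromovHyperbolic X] (o : X) : Type _ :=
  Quotient (gromovSetoid o)

section

variable {X : Type*} [MetricSpace X] [GromovHyperbolic X]

/-- The boundary point represented by a Gromov sequence. -/
def GromovSeq.toBoundary {o : X} (x : GromovSeq o) : GromovBoundary o :=
  Quotient.mk (gromovSetoid o) x

/-- The action of an isometry on Gromov sequences. -/
def GromovSeq.map {o : X} (g : X ≃ᵢ X) (x : GromovSeq o) : GromovSeq o :=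
  ⟨fun n => g (x.1 n), tendsto_atTop_mono (fun p => gromovProd_map g o (x.1 p.1) (x.1 p.2))
    (tendsto_atTop_add_const_right _ (-dist o (g o)) x.2)⟩

/-- The extension of an isometry `g` to the Gromov boundary. -/
def boundaryMap {o : X} (g : X ≃ᵢ X) : GromovBoundary o → GromovBoundary o :=
  Quotient.map (sa := gromovSetoid o) (sb := gromovSetoid o) (GromovSeq.map g)
    (fun x y h => tendsto_atTop_mono (fun n => gromovProd_map g o (x.1 n) (y.1 n))
      (tendsto_atTop_add_const_right _ (-dist o (g o)) h))

/-- `⟨ξ|η⟩_z` for `ξ, η ∈ ∂X`: the infimum of `liminf_{n,m} ⟨x_n|y_m⟩_z` over all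
representatives `x ∈ ξ`, `y ∈ η`. -/
def boundaryProd {o : X} (z : X) (ξ η : GromovBoundary o) : EReal :=
  ⨅ (x : GromovSeq o) (y : GromovSeq o) (_ : x.toBoundary = ξ) (_ : y.toBoundary = η),
    liminf (fun p : ℕ × ℕ => (gromovProd z (x.1 p.1) (y.1 p.2) : EReal)) atTop

/-- `⟨y|ξ⟩_z` for `y ∈ X`, `ξ ∈ ∂X`: the infimum of `liminf_n ⟨x_n|y⟩_z` over all
representatives `x ∈ ξ`. -/
def pointBoundaryProd {o : X} (z y : X) (ξ : GromovBoundary o) : EReal :=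
  ⨅ (x : GromovSeq o) (_ : x.toBoundary = ξ),
    liminf (fun n : ℕ => (gromovProd z (x.1 n) y : EReal)) atTop

/-- `b ^ (-t)` for an extended real `t`, with `b ^ (-∞) = 0`
(the value `t = -∞` never occurs for Gromov products, which are nonnegative). -/
def negPow (b : ℝ) (t : EReal) : ℝ := if t = ⊤ then 0 else b ^ (-t.toReal)

/-- The metric on `∂X` is a visual metric from `o` with parameter `b`:
`D(ξ, η) ≍ b ^ (-⟨ξ|η⟩_o)` up to a multiplicative constant. -/
def IsVisualMetric (o : X) [MetricSpace (GromovBoundary o)] (b : ℝ) : Prop :=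
  ∃ C : ℝ, 0 < C ∧ ∀ ξ η : GromovBoundary o,
    C⁻¹ * negPow b (boundaryProd o ξ η) ≤ dist ξ η ∧
      dist ξ η ≤ C * negPow b (boundaryProd o ξ η)

/-- `G` is strongly discrete: only finitely many `g ∈ G` move `o` by at most `r`, for each `r`. -/
def IsStronglyDiscrete (o : X) (G : Subgroup (X ≃ᵢ X)) : Prop :=
  ∀ r : ℝ, 0 < r → {g : X ≃ᵢ X | g ∈ G ∧ dist o (g o) ≤ r}.Finite

/-- `p` and `q` are fixed points of `g`, and the iterates of `g` converge to `p`, uniformly on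
the complement of each neighbourhood of `q`. -/
def IsAttractingRepelling {o : X} [MetricSpace (GromovBoundary o)] (g : X ≃ᵢ X)
    (p q : GromovBoundary o) : Prop :=
  boundaryMap g p = p ∧ boundaryMap g q = q ∧
    ∀ U ∈ 𝓝 q, TendstoUniformlyOn (fun (n : ℕ) (η : GromovBoundary o) => boundaryMap (g ^ n) η)
      (fun _ => p) atTop Uᶜ

/-- `g` is loxodromic, with attracting fixed point `p` and repelling fixed point `q ≠ p`. -/
def IsLoxodromicWith {o : X} [MetricSpace (GromovBoundary o)] (g : X ≃ᵢ X)
    (p q : GromovBoundary o) : Prop :=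
  p ≠ q ∧ IsAttractingRepelling g p q ∧ IsAttractingRepelling g⁻¹ q p

/-- `G` is of general type: it contains two loxodromic isometries with disjoint sets of
fixed points. -/
def IsOfGeneralType (o : X) [MetricSpace (GromovBoundary o)] (G : Subgroup (X ≃ᵢ X)) : Prop :=
  ∃ g₁ ∈ G, ∃ g₂ ∈ G, ∃ p₁ q₁ p₂ q₂ : GromovBoundary o,
    IsLoxodromicWith g₁ p₁ q₁ ∧ IsLoxodromicWith g₂ p₂ q₂ ∧
      Disjoint ({p₁, q₁} : Set (GromovBoundary o)) {p₂, q₂}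

/-- The sequence `(x_n)` in `X` converges to the boundary point `η`: `⟨x_n|η⟩_o → +∞`. -/
def ConvergesTo {o : X} (x : ℕ → X) (η : GromovBoundary o) : Prop :=
  Tendsto (fun n => pointBoundaryProd o (x n) η) atTop (𝓝 ⊤)

/-- `(x_n)` converges to `η` `σ`-radially: every `η ∈ Shad(x_n, σ)`, i.e. `⟨o|η⟩_{x_n} ≤ σ`. -/
def ConvergesRadially {o : X} (σ : ℝ) (x : ℕ → X) (η : GromovBoundary o) : Prop :=
  ConvergesTo x η ∧ ∀ n, pointBoundaryProd (x n) o η ≤ (σ : EReal)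

/-- `(x_n)` converges to `η` `σ`-uniformly radially: it converges `σ`-radially, it starts at `o`,
and its steps have length at most `σ`. -/
def ConvergesUniformlyRadially {o : X} (σ : ℝ) (x : ℕ → X) (η : GromovBoundary o) : Prop :=
  ConvergesRadially σ x η ∧ (∀ n, dist (x n) (x (n + 1)) ≤ σ) ∧ x 0 = o

/-- The radial limit set `Λ_r` of `G`. -/
def radialLimitSet (o : X) (G : Subgroup (X ≃ᵢ X)) : Set (GromovBoundary o) :=
  {η | ∃ g : ℕ → X ≃ᵢ X, (∀ n, g n ∈ G) ∧
    ∃ σ : ℝ, 0 < σ ∧ ConvergesRadially σ (fun n => g n o) η}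

/-- The uniformly radial limit set `Λ_ur` of `G`. -/
def uniformlyRadialLimitSet (o : X) (G : Subgroup (X ≃ᵢ X)) : Set (GromovBoundary o) :=
  {η | ∃ g : ℕ → X ≃ᵢ X, (∀ n, g n ∈ G) ∧
    ∃ σ : ℝ, 0 < σ ∧ ConvergesUniformlyRadially σ (fun n => g n o) η}

/-- The Poincaré exponent `δ` of `G` relative to `b`: the infimum (possibly `∞`) of the `s ≥ 0`
for which the Poincaré series `∑_{g ∈ G} b ^ (-s d(o, g o))` converges. -/
def poincareExponent (o : X) (b : ℝ) (G : Subgroup (X ≃ᵢ X)) : ℝ≥0∞ :=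
  ⨅ (s : ℝ≥0) (_ : Summable fun g : G => b ^ (-((s : ℝ) * dist o (g.1 o)))), (s : ℝ≥0∞)

/-- The set `BA_ξ` of radial limit points of `G` that are badly approximable with respect
to `ξ`. -/
def badlyApproximable {o : X} [MetricSpace (GromovBoundary o)] (b : ℝ) (G : Subgroup (X ≃ᵢ X))
    (ξ : GromovBoundary o) : Set (GromovBoundary o) :=
  {η | η ∈ radialLimitSet o G ∧
    ∃ ε : ℝ, 0 < ε ∧ ∀ g ∈ G, ε * b ^ (-dist o (g o)) ≤ dist (boundaryMap g ξ) η}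

/-- Optimality of the Dirichlet bound `D(g ξ, η) ≤ C b ^ (-d(o, g o))`, for infinitely many
`g ∈ G`: it cannot be improved, for all radial limit points `η`, by a factor
`φ(b ^ d(o, g o))` with `φ → 0` at `+∞`. The constant `C` may depend on `η`. -/
def DirichletOptimal {o : X} [MetricSpace (GromovBoundary o)] (b : ℝ) (G : Subgroup (X ≃ᵢ X))
    (ξ : GromovBoundary o) : Prop :=
  ¬ ∃ φ : ℝ → ℝ, Tendsto φ atTop (𝓝 0) ∧
    ∀ η ∈ radialLimitSet o G, ∃ C : ℝ, 0 < C ∧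
      {g : X ≃ᵢ X | g ∈ G ∧ dist (boundaryMap g ξ) η ≤
        C * b ^ (-dist o (g o)) * φ (b ^ dist o (g o))}.Infinite

end

end HypDioph

end

open HypDioph

open HypDioph

/-! The chain HD(⋂ BA ∩ Λ_ur) ≤ HD(Λ_r) ≤ δ ≤ HD(⋂ BA ∩ Λ_ur) gives both equalities. The first
inequality is inclusion. The second covers Λ_r by shadows of orbit points: the shadow of `g o` has
diameter ≲ b^(-d(o, g o)), so the Poincaré series bounds the Hausdorff measure
(`dimH_radialLimitSet_le`).

For the third, let s < δ. Orbit points in a thin annulus, thinned out and extended on both sides by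
large powers of two independent loxodromics, form a Schottky family of M + 1 isometries with
displacement at most ℓ and b^(sℓ) ≤ M (`exists_large_schottkyFamily`). Infinite words in these
letters code uniformly radial points.

Suppose `g ξ` is too close to the point coded by w. Translating by g⁻¹, the path of w from g⁻¹ o
follows the ray towards ξ for a time longer than d(o, g o). It therefore joins the ray from o to ξ,
and from some orbit point h o it follows this ray for a time longer than d(o, h o): w contains a
forbidden segment of about d(o, h o)/ℓ + t letters (`exists_forbidden`). A ray determines the
letters that follow it, so h determines the segment. By strong discreteness boundedly many orbit
points lie near the ray at each distance, so the weights (2/3)^|v| of the forbidden words have a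
finite sum, which becomes small as t grows. Choosing t for each ξ_k makes the total over countably
many directions small (`exists_small_forbidden`).

A potential argument then shows that, reading letter by letter, at most one of the M + 1 letters is
dangerous at each time. Hence an M-ary tree of words avoids every forbidden segment
(`exists_avoiding_tree`). Its branches code points separated by b^(-ℓ(j+1)) up to a constant when
they first differ at position j, and base-M expansion is an s-Hölder map from them whose image
contains [0, 1), so the dimension is at least s (`le_dimH_of_coding`). -/

namespace HypDioph

/-! ### Gromov products and Gromov's inequality -/

section GromovProduct

variable {X : Type*} [MetricSpace X]

/-- Gromov's inequality with the explicit nonnegative constant `c`. -/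
def HyperbolicWith (X : Type*) [MetricSpace X] (c : ℝ) : Prop :=
  0 ≤ c ∧ ∀ x y z w : X, min (gromovProd w x y) (gromovProd w y z) - c ≤ gromovProd w x z

theorem exists_hyperbolicWith [GromovHyperbolic X] : ∃ c : ℝ, HyperbolicWith X c := by
  obtain ⟨C, hC⟩ := GromovHyperbolic.gromov_ineq (X := X)
  refine ⟨max C 0, le_max_right _ _, fun x y z w => ?_⟩
  have := hC x y z w
  have := le_max_left C 0
  linarith

theorem gromovProd_nonneg (z x y : X) : 0 ≤ gromovProd z x y := by
  have := dist_triangle_right x y z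
  simp only [gromovProd]; linarith

theorem gromovProd_le_dist_left (z x y : X) : gromovProd z x y ≤ dist z x := by
  have := dist_triangle y x z
  rw [dist_comm y x] at this
  rw [dist_comm z x]
  simp only [gromovProd]; linarith

theorem gromovProd_le_dist_right (z x y : X) : gromovProd z x y ≤ dist z y := by
  rw [gromovProd_comm]; exact gromovProd_le_dist_left z y x

/-- `⟨x|y⟩_z + ⟨x|z⟩_y = d(z, y)`. -/
theorem gromovProd_add_swap (z x y : X) :
    gromovProd z x y + gromovProd y x z = dist z y := by
  simp only [gromovProd, dist_comm y z]; ring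

theorem gromovProd_isometryEquiv (g : X ≃ᵢ X) (z x y : X) :
    gromovProd (g z) (g x) (g y) = gromovProd z x y := by
  simp only [gromovProd, g.dist_eq]

theorem gromovProd_inv_left (g : X ≃ᵢ X) (z x y : X) :
    gromovProd (g⁻¹ z) x y = gromovProd z (g x) (g y) := by
  rw [← gromovProd_isometryEquiv g]
  congr 1
  exact g.apply_symm_apply z

theorem gromovProd_le_add_dist (z w x y : X) :
    gromovProd z x y ≤ gromovProd w x y + dist z w := by
  have h1 := dist_triangle x w z
  have h2 := dist_triangle y w z
  rw [dist_comm w z] at h1 h2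
  simp only [gromovProd]; linarith

theorem HyperbolicWith.min_le {c : ℝ} (h : HyperbolicWith X c) (w x y z : X) :
    min (gromovProd w x y) (gromovProd w y z) ≤ gromovProd w x z + c := by
  have := h.2 x y z w; linarith

/-- If `⟨x|z⟩_w ≤ t` and `⟨x|y⟩_w > t + c` then `⟨y|z⟩_w ≤ t + c`. -/
theorem HyperbolicWith.le_of_lt {c : ℝ} (h : HyperbolicWith X c) {w x y z : X} {t : ℝ}
    (h1 : gromovProd w x z ≤ t) (h2 : t + c < gromovProd w x y) :
    gromovProd w y z ≤ t + c := by
  have := h.min_le w x y z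
  rcases min_le_iff.1 this with h3 | h3 <;> linarith

theorem HyperbolicWith.le_of_le {c : ℝ} (h : HyperbolicWith X c) {w x y z : X} {t : ℝ}
    (h1 : t ≤ gromovProd w x y) (h2 : t ≤ gromovProd w y z) :
    t - c ≤ gromovProd w x z := by
  have := h.min_le w x y z
  have := le_min h1 h2
  linarith

/-- The four-point form of Gromov's inequality. -/
theorem HyperbolicWith.four_point {c : ℝ} (h : HyperbolicWith X c) (x y z w : X) :
    dist x z + dist y w ≤ max (dist x y + dist z w) (dist y z + dist x w) + 2 * c := by
  have := h.min_le w x y z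
  simp only [gromovProd] at this
  rcases min_le_iff.1 this with h3 | h3
  · have := le_max_left (dist x y + dist z w) (dist y z + dist x w); linarith
  · have := le_max_right (dist x y + dist z w) (dist y z + dist x w); linarith

end GromovProduct

/-! ### Sequences and change of representatives -/

section Sequences

variable {X : Type*} [MetricSpace X]

/-- The full `(n, m)`-limit `⟨x_n|y_m⟩_z → ∞`. -/
def ProdTendsto (z : X) (x y : ℕ → X) : Prop :=
  ∀ t : ℝ, ∃ N, ∀ n ≥ N, ∀ m ≥ N, t ≤ gromovProd z (x n) (y m)

theorem tendsto_pair_iff (z : X) (x y : ℕ → X) :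
    Tendsto (fun p : ℕ × ℕ => gromovProd z (x p.1) (y p.2)) atTop atTop ↔ ProdTendsto z x y := by
  rw [tendsto_atTop]
  refine forall_congr' fun t => ?_
  rw [eventually_atTop]
  constructor
  · rintro ⟨⟨a, b⟩, h⟩
    exact ⟨max a b, fun n hn m hm => h (n, m)
      ⟨(le_max_left _ _).trans hn, (le_max_right _ _).trans hm⟩⟩
  · rintro ⟨N, h⟩
    exact ⟨(N, N), fun p hp => h p.1 hp.1 p.2 hp.2⟩

theorem ProdTendsto.base {z : X} {x y : ℕ → X} (h : ProdTendsto z x y) (w : X) :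
    ProdTendsto w x y := fun t => by
  obtain ⟨N, hN⟩ := h (t + dist z w)
  refine ⟨N, fun n hn m hm => ?_⟩
  have := hN n hn m hm
  have := gromovProd_le_add_dist z w (x n) (y m)
  linarith

theorem ProdTendsto.symm {z : X} {x y : ℕ → X} (h : ProdTendsto z x y) :
    ProdTendsto z y x := fun t => by
  obtain ⟨N, hN⟩ := h t
  exact ⟨N, fun n hn m hm => by rw [gromovProd_comm]; exact hN m hm n hn⟩

theorem ProdTendsto.trans {c : ℝ} (hX : HyperbolicWith X c) {z : X} {x y w : ℕ → X}
    (h : ProdTendsto z x y) (h' : ProdTendsto z y w) : ProdTendsto z x w := fun t => by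
  obtain ⟨N, hN⟩ := h (t + c)
  obtain ⟨M, hM⟩ := h' (t + c)
  refine ⟨max N M, fun n hn m hm => ?_⟩
  have := hX.le_of_le (hN n (le_of_max_le_left hn) (max N M) (le_max_left _ _))
    (hM (max N M) (le_max_right _ _) m (le_of_max_le_right hm))
  linarith

/-- An upper bound for `⟨x_n|y_n⟩_z` along a subsequence passes, up to `2c`, to all late terms of
equivalent sequences. -/
theorem HyperbolicWith.eventually_le {c : ℝ} (hX : HyperbolicWith X c) {z : X}
    {x y x' y' : ℕ → X} (hx : ProdTendsto z x x') (hy : ProdTendsto z y y') {t : ℝ}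
    (h : ∃ᶠ p : ℕ × ℕ in atTop, gromovProd z (x p.1) (y p.2) ≤ t) :
    ∃ N, ∀ n ≥ N, ∀ m ≥ N, gromovProd z (x' n) (y' m) ≤ t + 2 * c := by
  obtain ⟨N, hN⟩ := hx (t + 2 * c + 1)
  obtain ⟨M, hM⟩ := hy (t + 2 * c + 1)
  obtain ⟨⟨i, j⟩, hij, hp⟩ := (frequently_atTop.1 h) (max N M, max N M)
  refine ⟨max N M, fun n hn m hm => ?_⟩
  have hc := hX.1
  have h1 := hN i ((le_max_left _ _).trans hij.1) n (le_of_max_le_left hn)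
  have h2 := hM j ((le_max_right _ _).trans hij.2) m (le_of_max_le_right hm)
  have h3 := hX.le_of_lt (y := x' n) hp (by simp only; linarith)
  rw [gromovProd_comm] at h3
  have h4 := hX.le_of_lt (y := y' m) h3 (by simp only; linarith)
  rw [gromovProd_comm] at h4
  linarith

/-- An upper bound for `⟨x_n|y⟩_z` along a subsequence passes, up to `c`, to all late terms of
an equivalent sequence. -/
theorem HyperbolicWith.eventually_point_le {c : ℝ} (hX : HyperbolicWith X c) {z y : X}
    {x x' : ℕ → X} (hx : ProdTendsto z x x') {t : ℝ}
    (h : ∃ᶠ n in atTop, gromovProd z (x n) y ≤ t) :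
    ∃ N, ∀ n ≥ N, gromovProd z (x' n) y ≤ t + c := by
  obtain ⟨N, hN⟩ := hx (t + c + 1)
  obtain ⟨i, hi, hp⟩ := (frequently_atTop.1 h) N
  refine ⟨N, fun n hn => ?_⟩
  have h1 := hN i hi n hn
  exact hX.le_of_lt hp (by linarith)

theorem GromovSeq.prodTendsto {o : X} (x : GromovSeq o) (z : X) : ProdTendsto z x.1 x.1 :=
  ((tendsto_pair_iff o x.1 x.1).1 x.2).base z

end Sequences

/-! ### Boundary points and visual metrics -/

section Boundary

variable {X : Type*} [MetricSpace X] [GromovHyperbolic X] {o : X}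

theorem ProdTendsto.toBoundary_eq {x y : GromovSeq o} {z : X} (h : ProdTendsto z x.1 y.1) :
    x.toBoundary = y.toBoundary := by
  refine Quotient.sound (s := gromovSetoid o) (tendsto_atTop.2 fun t => ?_)
  obtain ⟨N, hN⟩ := h.base o t
  exact eventually_atTop.2 ⟨N, fun n hn => hN n hn n hn⟩

/-- The equivalence relation controls only the diagonal n = m. Passing through a common large index,
with the Gromov property of each sequence, frees the two indices. -/
theorem GromovSeq.prodTendsto_of_eq {x y : GromovSeq o} (h : x.toBoundary = y.toBoundary)
    (z : X) : ProdTendsto z x.1 y.1 := by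
  obtain ⟨c, hX⟩ := exists_hyperbolicWith (X := X)
  have h1 : Tendsto (fun n => gromovProd o (x.1 n) (y.1 n)) atTop atTop :=
    Quotient.exact (s := gromovSetoid o) h
  refine ProdTendsto.base (z := o) (fun t => ?_) z
  obtain ⟨N, hN⟩ := x.prodTendsto o (t + c)
  obtain ⟨M, hM⟩ := y.prodTendsto o (t + 2 * c)
  obtain ⟨P, hP⟩ := eventually_atTop.1 (h1.eventually_ge_atTop (t + 2 * c))
  refine ⟨max N (max M P), fun n hn m hm => ?_⟩
  have e1 := hN n (le_of_max_le_left hn) (max N (max M P)) (le_max_left _ _)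
  have e2 := hP (max N (max M P)) ((le_max_right M P).trans (le_max_right _ _))
  have e3 := hM (max N (max M P)) ((le_max_left M P).trans (le_max_right _ _)) m
    ((le_max_left M P).trans (le_of_max_le_right hm))
  have e4 := hX.le_of_le e2 e3
  have := hX.le_of_le e1 (by linarith : t + c ≤ _)
  linarith

theorem exists_gromovSeq (ξ : GromovBoundary o) : ∃ x : GromovSeq o, x.toBoundary = ξ :=
  Quotient.exists_rep ξ

theorem toBoundary_map (g : X ≃ᵢ X) (x : GromovSeq o) :
    (GromovSeq.map g x).toBoundary = boundaryMap g x.toBoundary := rfl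

theorem boundaryMap_mul (g h : X ≃ᵢ X) (ξ : GromovBoundary o) :
    boundaryMap (g * h) ξ = boundaryMap g (boundaryMap h ξ) := by
  obtain ⟨x, rfl⟩ := exists_gromovSeq ξ
  rfl

theorem boundaryMap_one (ξ : GromovBoundary o) : boundaryMap (1 : X ≃ᵢ X) ξ = ξ := by
  obtain ⟨x, rfl⟩ := exists_gromovSeq ξ
  rfl

theorem boundaryMap_pow_eq {g : X ≃ᵢ X} {ξ : GromovBoundary o} (h : boundaryMap g ξ = ξ) (m : ℕ) :
    boundaryMap (g ^ m) ξ = ξ := by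
  induction m with
  | zero => rw [pow_zero, boundaryMap_one]
  | succ k ih => rw [pow_succ, boundaryMap_mul, h, ih]

theorem boundaryProd_le_of_frequently {x y : GromovSeq o} {z : X} {t : ℝ}
    (h : ∃ᶠ p : ℕ × ℕ in atTop, gromovProd z (x.1 p.1) (y.1 p.2) ≤ t) :
    boundaryProd z x.toBoundary y.toBoundary ≤ (t : EReal) :=
  (iInf₂_le_of_le x y <| (iInf_le _ rfl).trans (iInf_le _ rfl)).trans <|
    liminf_le_of_frequently_le (h.mono fun _ hp => EReal.coe_le_coe_iff.2 hp)

theorem le_boundaryProd {ξ η : GromovBoundary o} {z : X} {t : ℝ}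
    (h : ∀ x y : GromovSeq o, x.toBoundary = ξ → y.toBoundary = η →
      ∃ N, ∀ n ≥ N, ∀ m ≥ N, t ≤ gromovProd z (x.1 n) (y.1 m)) :
    (t : EReal) ≤ boundaryProd z ξ η := by
  refine le_iInf₂ fun x y => le_iInf₂ fun hx hy => ?_
  obtain ⟨N, hN⟩ := h x y hx hy
  refine le_liminf_of_le (h := eventually_atTop.2 ⟨(N, N), fun p hp =>
    EReal.coe_le_coe_iff.2 (hN p.1 hp.1 p.2 hp.2)⟩)

theorem lt_of_lt_boundaryProd {x y : GromovSeq o} {z : X} {t : ℝ}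
    (h : (t : EReal) < boundaryProd z x.toBoundary y.toBoundary) :
    ∃ N, ∀ n ≥ N, ∀ m ≥ N, t < gromovProd z (x.1 n) (y.1 m) := by
  by_contra hcon
  push Not at hcon
  refine absurd h (not_lt.2 (boundaryProd_le_of_frequently ?_))
  rw [frequently_atTop]
  rintro ⟨a, b⟩
  obtain ⟨n, hn, m, hm, hnm⟩ := hcon (max a b)
  exact ⟨(n, m), ⟨le_of_max_le_left hn, le_of_max_le_right hm⟩, hnm⟩

theorem pointBoundaryProd_le_of_frequently {x : GromovSeq o} {z y : X} {t : ℝ}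
    (h : ∃ᶠ n in atTop, gromovProd z (x.1 n) y ≤ t) :
    pointBoundaryProd z y x.toBoundary ≤ (t : EReal) :=
  (iInf_le_of_le x <| iInf_le _ rfl).trans <|
    liminf_le_of_frequently_le (h.mono fun _ hp => EReal.coe_le_coe_iff.2 hp)

theorem le_pointBoundaryProd {ξ : GromovBoundary o} {z y : X} {t : ℝ}
    (h : ∀ x : GromovSeq o, x.toBoundary = ξ → ∃ N, ∀ n ≥ N, t ≤ gromovProd z (x.1 n) y) :
    (t : EReal) ≤ pointBoundaryProd z y ξ := by
  refine le_iInf₂ fun x hx => ?_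
  obtain ⟨N, hN⟩ := h x hx
  exact le_liminf_of_le (h := eventually_atTop.2 ⟨N, fun n hn => EReal.coe_le_coe_iff.2 (hN n hn)⟩)

/-- If `⟨y|ξ⟩_z < t` then `⟨x_n|y⟩_z ≤ t + c` for all late terms of each representative. -/
theorem HyperbolicWith.eventually_le_of_pointBoundaryProd_lt {c : ℝ} (hX : HyperbolicWith X c)
    {x : GromovSeq o} {z y : X} {t : ℝ} (h : pointBoundaryProd z y x.toBoundary < (t : EReal)) :
    ∃ N, ∀ n ≥ N, gromovProd z (x.1 n) y ≤ t + c := by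
  simp only [pointBoundaryProd, iInf_lt_iff] at h
  obtain ⟨x', hx', h⟩ := h
  refine hX.eventually_point_le (GromovSeq.prodTendsto_of_eq hx' z) ?_
  have := frequently_lt_of_liminf_lt (h := h)
  exact this.mono fun n hn => (EReal.coe_lt_coe_iff.1 hn).le

theorem negPow_le {b : ℝ} (hb : 1 < b) {t : ℝ} {e : EReal} (h : (t : EReal) ≤ e) :
    negPow b e ≤ b ^ (-t) := by
  unfold negPow
  split_ifs with he
  · positivity
  · refine Real.rpow_le_rpow_of_exponent_le hb.le (neg_le_neg ?_)
    induction e with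
    | bot => simp at h
    | top => simp at he
    | coe r => simpa using h

theorem le_negPow {b : ℝ} (hb : 1 < b) {t : ℝ} {e : EReal} (h : e ≤ (t : EReal)) (h0 : 0 ≤ e) :
    b ^ (-t) ≤ negPow b e := by
  unfold negPow
  rw [if_neg (by rintro rfl; simp at h)]
  refine Real.rpow_le_rpow_of_exponent_le hb.le (neg_le_neg ?_)
  induction e with
  | bot => simp at h0
  | top => simp at h
  | coe r => simpa using h

theorem boundaryProd_nonneg (z : X) (ξ η : GromovBoundary o) : 0 ≤ boundaryProd z ξ η := by
  have := le_boundaryProd (ξ := ξ) (η := η) (z := z) (t := 0) fun x y _ _ =>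
    ⟨0, fun n _ m _ => gromovProd_nonneg _ _ _⟩
  simpa using this

/-- The comparison of a visual metric with `b ^ (-t)`. -/
theorem IsVisualMetric.exists_const [MetricSpace (GromovBoundary o)] {b : ℝ} (hb : 1 < b)
    (hD : IsVisualMetric o b) : ∃ C : ℝ, 0 < C ∧ ∀ (ξ η : GromovBoundary o) (t : ℝ),
      ((t : EReal) ≤ boundaryProd o ξ η → dist ξ η ≤ C * b ^ (-t)) ∧
      (boundaryProd o ξ η ≤ (t : EReal) → C⁻¹ * b ^ (-t) ≤ dist ξ η) := by
  obtain ⟨C, hC, h⟩ := hD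
  refine ⟨C, hC, fun ξ η t => ⟨fun ht => (h ξ η).2.trans ?_, fun ht => le_trans ?_ (h ξ η).1⟩⟩
  · exact mul_le_mul_of_nonneg_left (negPow_le hb ht) hC.le
  · exact mul_le_mul_of_nonneg_left (le_negPow hb ht (boundaryProd_nonneg _ _ _)) (by positivity)

end Boundary

theorem IsStronglyDiscrete.countable {X : Type*} [MetricSpace X] {o : X}
    {G : Subgroup (X ≃ᵢ X)} (hG : IsStronglyDiscrete o G) :
    Countable G := by
  have : (G : Set (X ≃ᵢ X)) ⊆ ⋃ n : ℕ, {g : X ≃ᵢ X | g ∈ G ∧ dist o (g o) ≤ n + 1} := by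
    intro g hg
    obtain ⟨n, hn⟩ := exists_nat_ge (dist o (g o))
    exact Set.mem_iUnion.2 ⟨n, hg, by linarith⟩
  exact ((Set.countable_iUnion fun n : ℕ => (hG (n + 1) (by positivity)).countable).mono
    this).to_subtype

/-! ### Upper bound by shadows -/

section UpperBound

open MeasureTheory

variable {X : Type*} [MetricSpace X] [GromovHyperbolic X] {o : X}

/-- Rays from o to points of the shadow of y pass near y, so two of them agree for a time about d(o,
y). In a visual metric this bounds the diameter of the shadow. -/
theorem le_boundaryProd_of_shadow {c : ℝ} (hX : HyperbolicWith X c) {y : X} {σ : ℝ}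
    {η η' : GromovBoundary o} (h : pointBoundaryProd y o η ≤ (σ : EReal))
    (h' : pointBoundaryProd y o η' ≤ (σ : EReal)) :
    ((dist o y - (σ + 1 + 2 * c) : ℝ) : EReal) ≤ boundaryProd o η η' := by
  refine le_boundaryProd fun x x' hx hx' => ?_
  subst hx hx'
  have hσ : (σ : EReal) < ((σ + 1 : ℝ) : EReal) := EReal.coe_lt_coe_iff.2 (by linarith)
  obtain ⟨N, hN⟩ := hX.eventually_le_of_pointBoundaryProd_lt (h.trans_lt hσ)
  obtain ⟨M, hM⟩ := hX.eventually_le_of_pointBoundaryProd_lt (h'.trans_lt hσ)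
  refine ⟨max N M, fun n hn m hm => ?_⟩
  have h1 := hN n (le_of_max_le_left hn)
  have h2 := hM m (le_of_max_le_right hm)
  have e1 := gromovProd_add_swap o (x.1 n) y
  have e2 := gromovProd_add_swap o (x'.1 m) y
  rw [gromovProd_comm o (x'.1 m)] at e2
  have := hX.le_of_le (w := o) (x := x.1 n) (y := y) (z := x'.1 m) (t := dist o y - (σ + 1 + c))
    (by linarith) (by linarith)
  linarith

theorem pointBoundaryProd_le_dist (z y : X) (η : GromovBoundary o) :
    pointBoundaryProd z y η ≤ (dist z y : EReal) := by
  obtain ⟨x, rfl⟩ := exists_gromovSeq η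
  exact pointBoundaryProd_le_of_frequently
    (Frequently.of_forall fun n => gromovProd_le_dist_right _ _ _)

theorem ConvergesTo.exists_dist_ge {x : ℕ → X} {η : GromovBoundary o} (h : ConvergesTo x η)
    (t : ℝ) : ∃ n, t ≤ dist o (x n) := by
  have := (EReal.tendsto_nhds_top_iff_real.1 h) t
  obtain ⟨n, hn⟩ := this.exists
  exact ⟨n, (EReal.coe_lt_coe_iff.1 (hn.trans_le (pointBoundaryProd_le_dist _ _ _))).le⟩

/-- For fixed σ every limit point lies in σ-shadows of orbit points arbitrarily far from o; these
shadows are covers whose s-sums are dominated by the Poincaré series. Countable stability of the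
dimension removes σ. -/
theorem dimH_radialLimitSet_le [MetricSpace (GromovBoundary o)] {b : ℝ} (hb : 1 < b)
    (hD : IsVisualMetric o b) {G : Subgroup (X ≃ᵢ X)} (hG : IsStronglyDiscrete o G) :
    dimH (radialLimitSet o G) ≤ poincareExponent o b G := by
  obtain ⟨c, hX⟩ := exists_hyperbolicWith (X := X)
  obtain ⟨C, hC, hdist⟩ := hD.exists_const hb
  have hb0 : 0 < b := by linarith
  have := hG.countable
  refine le_iInf₂ fun s hs => ?_
  have hsub : radialLimitSet o G ⊆ ⋃ σ : ℕ, {η | ∃ g : ℕ → X ≃ᵢ X, (∀ n, g n ∈ G) ∧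
      ConvergesRadially (σ : ℝ) (fun n => g n o) η} := by
    rintro η ⟨g, hg, σ, -, h1, h2⟩
    obtain ⟨n, hn⟩ := exists_nat_ge σ
    exact Set.mem_iUnion.2 ⟨n, g, hg, h1, fun k => (h2 k).trans (EReal.coe_le_coe_iff.2 hn)⟩
  refine (dimH_mono hsub).trans ?_
  rw [dimH_iUnion]
  refine iSup_le fun σ => ?_
  borelize (GromovBoundary o)
  refine dimH_le_of_hausdorffMeasure_ne_top ?_
  set K : ℝ := C * b ^ ((σ : ℝ) + 1 + 2 * c) with hK
  have hK0 : 0 < K := by positivity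
  -- Shadows of points closer than n are made empty, so that the covers for all n are indexed by the
  -- same set G.
  let T : ℕ → G → Set (GromovBoundary o) := fun n g =>
    {η | (n : ℝ) ≤ dist o (g.1 o) ∧ pointBoundaryProd (g.1 o) o η ≤ ((σ : ℝ) : EReal)}
  have hdiam : ∀ n g, Metric.ediam (T n g) ≤ ENNReal.ofReal (K * b ^ (-dist o (g.1 o))) := by
    intro n g
    refine Metric.ediam_le fun η hη η' hη' => ?_
    rw [edist_dist]
    refine ENNReal.ofReal_le_ofReal ?_
    refine ((hdist η η' _).1 (le_boundaryProd_of_shadow hX hη.2 hη'.2)).trans_eq ?_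
    rw [hK, mul_assoc, ← Real.rpow_add hb0]
    congr 2; ring
  have hr : Tendsto (fun n : ℕ => ENNReal.ofReal (K * b ^ (-(n : ℝ)))) atTop (𝓝 0) := by
    rw [← ENNReal.ofReal_zero]
    refine ENNReal.tendsto_ofReal ?_
    rw [← mul_zero K]
    refine Tendsto.const_mul K ?_
    have := tendsto_pow_atTop_nhds_zero_of_lt_one (inv_nonneg.2 hb0.le) (inv_lt_one_of_one_lt₀ hb)
    refine this.congr fun n => ?_
    rw [Real.rpow_neg hb0.le, Real.rpow_natCast, inv_pow]
  have hmeas := Measure.hausdorffMeasure_le_liminf_tsum (X := GromovBoundary o) (s : ℝ)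
    {η | ∃ g : ℕ → X ≃ᵢ X, (∀ n, g n ∈ G) ∧ ConvergesRadially (σ : ℝ) (fun n => g n o) η}
    (fun n : ℕ => ENNReal.ofReal (K * b ^ (-(n : ℝ)))) hr T
    (Eventually.of_forall fun n g => ?_) (Eventually.of_forall fun n => ?_)
  · refine ne_top_of_le_ne_top (b := ∑' g : G,
      ENNReal.ofReal (K ^ (s : ℝ) * b ^ (-((s : ℝ) * dist o (g.1 o))))) ?_ ?_
    · exact (hs.mul_left _).tsum_ofReal_ne_top
    · refine hmeas.trans (liminf_le_of_frequently_le' (Frequently.of_forall fun n =>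
        ENNReal.tsum_le_tsum fun g => ?_))
      refine (ENNReal.rpow_le_rpow (hdiam n g) s.coe_nonneg).trans_eq ?_
      rw [ENNReal.ofReal_rpow_of_nonneg (by positivity) s.coe_nonneg,
        Real.mul_rpow hK0.le (by positivity), ← Real.rpow_mul hb0.le]
      congr 3; ring
  · by_cases hn : (n : ℝ) ≤ dist o (g.1 o)
    · refine (hdiam n g).trans (ENNReal.ofReal_le_ofReal ?_)
      exact mul_le_mul_of_nonneg_left
        (Real.rpow_le_rpow_of_exponent_le hb.le (by linarith)) hK0.le
    · have : T n g = ∅ := Set.eq_empty_of_forall_notMem fun η hη => hn hη.1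
      rw [this, Metric.ediam_empty]; exact zero_le
  · rintro η ⟨g, hg, h1, h2⟩
    obtain ⟨k, hk⟩ := h1.exists_dist_ge n
    exact Set.mem_iUnion.2 ⟨⟨g k, hg k⟩, hk, h2 k⟩

end UpperBound

/-! ### Loxodromic isometries in general position -/

section Loxodromic

section

variable {X : Type*} [MetricSpace X] {o : X}

theorem tendsto_dist_pow {G : Subgroup (X ≃ᵢ X)} (hG : IsStronglyDiscrete o G) {g : X ≃ᵢ X}
    (hg : g ∈ G) (hinf : ¬ IsOfFinOrder g) :
    Tendsto (fun m : ℕ => dist o ((g ^ m) o)) atTop atTop := by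
  refine tendsto_atTop.2 fun r => ?_
  have hfin := (hG (max r 1) (by positivity)).preimage
    (injective_pow_iff_not_isOfFinOrder.2 hinf).injOn
  rw [← Nat.cofinite_eq_atTop]
  filter_upwards [hfin.compl_mem_cofinite] with m hm
  by_contra hlt
  exact hm ⟨pow_mem hg m, (not_le.1 hlt).le.trans (le_max_left _ _)⟩

/-- Seen from o, the points u and v lie on the way to x and y, beyond the place where those rays
part. Replacing an endpoint by such a point costs one c. -/
theorem HyperbolicWith.gromovProd_le_of_near {c : ℝ} (hX : HyperbolicWith X c)
    {x y : GromovSeq o} {K K₁ K₂ : ℝ}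
    (hK : ∃ N, ∀ n ≥ N, ∀ m ≥ N, gromovProd o (x.1 n) (y.1 m) ≤ K) {u v : X}
    (hu : ∃ N, ∀ n ≥ N, dist o u - K₁ ≤ gromovProd o u (x.1 n))
    (hv : ∃ N, ∀ n ≥ N, dist o v - K₂ ≤ gromovProd o v (y.1 n))
    (hu' : K + 2 * c + K₁ < dist o u) (hv' : K + 2 * c + K₂ < dist o v) :
    gromovProd o u v ≤ K + 2 * c := by
  have hc := hX.1
  obtain ⟨N, hN⟩ := hK
  obtain ⟨N₁, hN₁⟩ := hu
  obtain ⟨N₂, hN₂⟩ := hv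
  set n := max N (max N₁ N₂)
  have e1 := hN n (le_max_left _ _) n (le_max_left _ _)
  have e2 := hN₁ n ((le_max_left _ _).trans (le_max_right _ _))
  have e3 := hN₂ n ((le_max_right _ _).trans (le_max_right _ _))
  rw [gromovProd_comm] at e2
  have e4 := hX.le_of_lt (y := u) e1 (by linarith)
  rw [gromovProd_comm] at e4 e3
  have e5 := hX.le_of_lt (x := y.1 n) (y := v) (z := u) e4 (by
    rw [gromovProd_comm] at e3 ⊢; linarith)
  rw [gromovProd_comm]
  linarith

end

variable {X : Type*} [MetricSpace X] [GromovHyperbolic X] {o : X}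

/-- Boundary points that are close in a visual metric have large Gromov product. -/
theorem lt_boundaryProd_of_dist_lt [MetricSpace (GromovBoundary o)] {C b : ℝ}
    (hdist : ∀ (ξ η : GromovBoundary o) (t : ℝ),
      ((t : EReal) ≤ boundaryProd o ξ η → dist ξ η ≤ C * b ^ (-t)) ∧
      (boundaryProd o ξ η ≤ (t : EReal) → C⁻¹ * b ^ (-t) ≤ dist ξ η))
    {ξ η : GromovBoundary o} {t : ℝ} (h : dist ξ η < C⁻¹ * b ^ (-t)) :
    (t : EReal) < boundaryProd o ξ η :=
  lt_of_not_ge fun h' => absurd ((hdist ξ η t).2 h') (not_le.2 h)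

/-- The constant has to serve all representatives: `IsLoxodromicWith.exists_near` applies it to the
images of one sequence under powers of g⁻¹. -/
theorem HyperbolicWith.exists_bound_of_ne {c : ℝ} (hX : HyperbolicWith X c) {x y : GromovSeq o}
    (h : x.toBoundary ≠ y.toBoundary) : ∃ K : ℝ, 0 ≤ K ∧ ∀ x' y' : GromovSeq o,
      x'.toBoundary = x.toBoundary → y'.toBoundary = y.toBoundary →
        ∃ N, ∀ n ≥ N, ∀ m ≥ N, gromovProd o (x'.1 n) (y'.1 m) ≤ K := by
  have h1 : ¬ ProdTendsto o x.1 y.1 := fun h' => h h'.toBoundary_eq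
  simp only [ProdTendsto] at h1
  push Not at h1
  obtain ⟨t, ht⟩ := h1
  refine ⟨max 0 (t + 2 * c), le_max_left _ _, fun x' y' hx hy => ?_⟩
  obtain ⟨N, hN⟩ := hX.eventually_le (GromovSeq.prodTendsto_of_eq hx.symm o)
    (GromovSeq.prodTendsto_of_eq hy.symm o) (t := t) (by
      rw [frequently_atTop]
      rintro ⟨i, j⟩
      obtain ⟨n, hn, m, hm, hnm⟩ := ht (max i j)
      exact ⟨(n, m), ⟨le_of_max_le_left hn, le_of_max_le_right hm⟩, hnm.le⟩)
  exact ⟨N, fun n hn m hm => (hN n hn m hm).trans (le_max_right _ _)⟩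

variable [MetricSpace (GromovBoundary o)]

theorem IsAttractingRepelling.tendsto {g : X ≃ᵢ X} {p q ρ : GromovBoundary o}
    (h : IsAttractingRepelling g p q) (hρ : ρ ≠ q) :
    Tendsto (fun m : ℕ => boundaryMap (g ^ m) ρ) atTop (𝓝 p) :=
  (h.2.2 {ρ}ᶜ (isOpen_compl_singleton.mem_nhds hρ.symm)).tendsto_at (by simp)

/-- If g ^ k = 1, then g ^ (k j) ρ is constantly ρ and yet converges to p. -/
theorem IsAttractingRepelling.not_isOfFinOrder {g : X ≃ᵢ X} {p q ρ : GromovBoundary o}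
    (h : IsAttractingRepelling g p q) (hρ : ρ ≠ q) (hρ' : ρ ≠ p) : ¬ IsOfFinOrder g := by
  intro hfin
  obtain ⟨k, hk, hgk⟩ := isOfFinOrder_iff_pow_eq_one.1 hfin
  have h1 : Tendsto (fun j : ℕ => boundaryMap (g ^ (k * j)) ρ) atTop (𝓝 p) :=
    (h.tendsto hρ).comp (tendsto_id.const_mul_atTop' hk)
  simp only [pow_mul, hgk, one_pow, boundaryMap_one] at h1
  exact hρ' (tendsto_nhds_unique tendsto_const_nhds h1)

/-- The orbit `g ^ m (o)` of a loxodromic isometry stays close to the rays towards the attracting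
fixed point. -/
theorem IsLoxodromicWith.exists_near {c b : ℝ} (hX : HyperbolicWith X c) (hb : 1 < b)
    (hD : IsVisualMetric o b) {G : Subgroup (X ≃ᵢ X)} (hG : IsStronglyDiscrete o G)
    {g : X ≃ᵢ X} (hg : g ∈ G) {p q ρ : GromovBoundary o} (h : IsLoxodromicWith g p q)
    (hp : ρ ≠ p) (hq : ρ ≠ q) {x : GromovSeq o} (hx : x.toBoundary = p) :
    ∃ K : ℝ, ∀ᶠ m : ℕ in atTop, ∃ N, ∀ n ≥ N,
      dist o ((g ^ m) o) - K ≤ gromovProd o ((g ^ m) o) (x.1 n) := by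
  have hc := hX.1
  obtain ⟨C, hC, hdist⟩ := hD.exists_const hb
  obtain ⟨y, hy⟩ := exists_gromovSeq q
  obtain ⟨r, hr⟩ := exists_gromovSeq ρ
  obtain ⟨K₁, -, hK₁⟩ := hX.exists_bound_of_ne (x := x) (y := y) (by rw [hx, hy]; exact h.1)
  obtain ⟨K₂, -, hK₂⟩ := hX.exists_bound_of_ne (x := r) (y := y) (by rw [hr, hy]; exact hq)
  have hlim : Tendsto (fun m : ℕ => boundaryMap (g⁻¹ ^ m) ρ) atTop (𝓝 q) := h.2.2.tendsto hp
  have hord : ¬ IsOfFinOrder g := h.2.1.not_isOfFinOrder hq hp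
  have hlen := tendsto_dist_pow hG hg hord
  have hfix : ∀ m : ℕ, boundaryMap (g⁻¹ ^ m) p = p := boundaryMap_pow_eq h.2.2.2.1
  have hfiy : ∀ m : ℕ, boundaryMap (g⁻¹ ^ m) q = q := boundaryMap_pow_eq h.2.2.1
  refine ⟨K₁ + c, ?_⟩
  filter_upwards [hlen.eventually_gt_atTop (K₂ + K₁ + 3 * c),
    (Metric.tendsto_nhds.1 hlim) (C⁻¹ * b ^ (-(K₁ + 3 * c + 1))) (by positivity)] with m hm hmq
  set Y := (g ^ m) o with hY
  -- Products at Y are products at o of images under g⁻ᵐ. These images fix p and q and, for large m,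
  -- bring ρ close to q, so from Y the directions of ρ and q almost agree while p stays apart.
  have hbase : ∀ a a' : X, gromovProd Y a a' = gromovProd o ((g⁻¹ ^ m) a) ((g⁻¹ ^ m) a') := by
    intro a a'
    rw [hY, ← gromovProd_inv_left, inv_pow, inv_inv]
  have hprod := lt_boundaryProd_of_dist_lt hdist hmq
  rw [← hr, ← hy, ← toBoundary_map] at hprod
  obtain ⟨N₁, hN₁⟩ := lt_of_lt_boundaryProd hprod
  have hymap : (GromovSeq.map (g⁻¹ ^ m) y).toBoundary = y.toBoundary := by
    rw [toBoundary_map, hy, hfiy]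
  have hxmap : (GromovSeq.map (g⁻¹ ^ m) x).toBoundary = x.toBoundary := by
    rw [toBoundary_map, hx, hfix]
  obtain ⟨N₂, hN₂⟩ := GromovSeq.prodTendsto_of_eq hymap o (K₁ + 3 * c + 1)
  obtain ⟨N₃, hN₃⟩ := hK₁ _ _ hxmap hymap
  obtain ⟨N₄, hN₄⟩ := hK₂ _ _ rfl rfl
  refine ⟨max (max N₁ N₂) (max N₃ N₄), fun n hn => ?_⟩
  have hn1 : N₁ ≤ n := (le_max_left _ _).trans (le_of_max_le_left hn)
  have hn2 : N₂ ≤ n := (le_max_right _ _).trans (le_of_max_le_left hn)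
  have hn3 : N₃ ≤ n := (le_max_left _ _).trans (le_of_max_le_right hn)
  have hn4 : N₄ ≤ n := (le_max_right _ _).trans (le_of_max_le_right hn)
  have e1 : K₁ + 3 * c + 1 < gromovProd o ((g⁻¹ ^ m) (r.1 n)) (y.1 n) := hN₁ n hn1 n hn1
  have e2 : K₁ + 3 * c + 1 ≤ gromovProd o ((g⁻¹ ^ m) (y.1 n)) (y.1 n) := hN₂ n hn2 n hn2
  have e3 : gromovProd o ((g⁻¹ ^ m) (x.1 n)) ((g⁻¹ ^ m) (y.1 n)) ≤ K₁ := hN₃ n hn3 n hn3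
  have e4 := hN₄ n hn4 n hn4
  rw [gromovProd_comm] at e2
  have e5 := hX.le_of_le e1.le e2
  rw [← hbase] at e3 e5
  have e6 := hX.min_le Y (x.1 n) o (y.1 n)
  have s1 := gromovProd_add_swap o (x.1 n) Y
  have s2 := gromovProd_add_swap o (y.1 n) Y
  have s3 := gromovProd_add_swap o (r.1 n) Y
  rw [gromovProd_comm o Y]
  rcases min_le_iff.1 (e6.trans (by linarith : _ ≤ K₁ + c)) with e7 | e7
  · linarith
  · exfalso
    rw [gromovProd_comm] at e7
    have e8 : gromovProd Y (r.1 n) o ≤ K₁ + 2 * c := by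
      rw [gromovProd_comm] at e5
      rcases min_le_iff.1 (hX.min_le Y (y.1 n) (r.1 n) o) with e9 | e9 <;> linarith
    have e9 := hX.le_of_le (w := o) (x := r.1 n) (y := Y) (z := y.1 n)
      (t := dist o Y - (K₁ + 2 * c)) (by linarith) (by rw [gromovProd_comm]; linarith)
    linarith

/-- Two loxodromic isometries of a strongly discrete group without common fixed points have large
powers in general position. -/
theorem exists_schottky_pair {c b : ℝ} (hX : HyperbolicWith X c) (hb : 1 < b)
    (hD : IsVisualMetric o b) {G : Subgroup (X ≃ᵢ X)} (hG : IsStronglyDiscrete o G)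
    (hG' : IsOfGeneralType o G) : ∃ K : ℝ, 0 ≤ K ∧ ∀ L : ℝ, ∃ t : Bool → X ≃ᵢ X,
      (∀ i, t i ∈ G) ∧ (∀ i, L ≤ dist o (t i o)) ∧
      (∀ i j, gromovProd o ((t i)⁻¹ o) (t j o) ≤ K) ∧
      (∀ i j, i ≠ j → gromovProd o (t i o) (t j o) ≤ K) ∧
      (∀ i j, i ≠ j → gromovProd o ((t i)⁻¹ o) ((t j)⁻¹ o) ≤ K) := by
  obtain ⟨g₁, hg₁, g₂, hg₂, p₁, q₁, p₂, q₂, h₁, h₂, hdisj⟩ := hG'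
  simp only [Set.disjoint_insert_left, Set.disjoint_singleton_left, Set.mem_insert_iff,
    Set.mem_singleton_iff, not_or] at hdisj
  obtain ⟨⟨n1, n2⟩, n3, n4⟩ := hdisj
  let g : Bool → X ≃ᵢ X := fun i => if i then g₁ else g₂
  let e : Bool → Bool → GromovBoundary o := fun i s =>
    if i then (if s then p₁ else q₁) else (if s then p₂ else q₂)
  have hgG : ∀ i, g i ∈ G := by rintro (_ | _) <;> assumption
  have hinv : ∀ {g : X ≃ᵢ X} {p q : GromovBoundary o}, IsLoxodromicWith g p q →
      IsLoxodromicWith g⁻¹ q p := fun h => ⟨h.1.symm, h.2.2, by rw [inv_inv]; exact h.2.1⟩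
  let γ : Bool → Bool → X ≃ᵢ X := fun i s => if s then g i else (g i)⁻¹
  have hγG : ∀ i s, γ i s ∈ G := by
    rintro i (_ | _)
    · exact inv_mem (hgG i)
    · exact hgG i
  have hlox : ∀ i s, IsLoxodromicWith (γ i s) (e i s) (e i !s) := by
    rintro (_ | _) (_ | _)
    · exact hinv h₂
    · exact h₂
    · exact hinv h₁
    · exact h₁
  have hne : ∀ i s i' s', (i, s) ≠ (i', s') → e i s ≠ e i' s' := by
    have := h₁.1
    have := h₂.1
    rintro (_ | _) (_ | _) (_ | _) (_ | _) h <;> simp_all [e] <;> tauto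
  choose x hx using fun i s => exists_gromovSeq (e i s)
  choose K hK using fun i s => (hlox i s).exists_near hX hb hD hG (hγG i s) (ρ := e (!i) s)
    (hne _ _ _ _ (by simp)) (hne _ _ _ _ (by simp)) (hx i s)
  choose B hB0 hB using fun (a a' : Bool × Bool) (h : a ≠ a') =>
    hX.exists_bound_of_ne (x := x a.1 a.2) (y := x a'.1 a'.2)
      (by rw [hx, hx]; exact hne _ _ _ _ h)
  obtain ⟨B', hB'⟩ : ∃ B', ∀ a a' h, B a a' h ≤ B' := by
    obtain ⟨t, ht⟩ := Finite.exists_le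
      fun a : {a : (Bool × Bool) × (Bool × Bool) // a.1 ≠ a.2} => B a.1.1 a.1.2 a.2
    exact ⟨t, fun a a' h => ht ⟨(a, a'), h⟩⟩
  have hB'0 : 0 ≤ B' := (hB0 (true, true) (false, false) (by simp)).trans (hB' _ _ _)
  have hc := hX.1
  -- The bound depends only on the four fixed points, through their representatives; it precedes L
  -- and the exponent m.
  refine ⟨B' + 2 * c, by linarith, fun L => ?_⟩
  have hlen : ∀ i s, Tendsto (fun m : ℕ => dist o ((γ i s ^ m) o)) atTop atTop := fun i s =>
    tendsto_dist_pow hG (hγG i s) ((hlox i s).2.1.not_isOfFinOrder (ρ := e (!i) s)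
      (hne _ _ _ _ (by simp)) (hne _ _ _ _ (by simp)))
  have hev : ∀ᶠ m : ℕ in atTop, ∀ i s, L ≤ dist o ((γ i s ^ m) o) ∧
      B' + 2 * c + K i s < dist o ((γ i s ^ m) o) ∧
      ∃ N, ∀ n ≥ N, dist o ((γ i s ^ m) o) - K i s ≤ gromovProd o ((γ i s ^ m) o) ((x i s).1 n) := by
    rw [eventually_all]
    intro i
    rw [eventually_all]
    intro s
    exact ((hlen i s).eventually_ge_atTop L).and
      (((hlen i s).eventually_gt_atTop _).and (hK i s))
  obtain ⟨m, hm⟩ := hev.exists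
  have key : ∀ a a' : Bool × Bool, a ≠ a' →
      gromovProd o ((γ a.1 a.2 ^ m) o) ((γ a'.1 a'.2 ^ m) o) ≤ B' + 2 * c := by
    intro a a' h
    obtain ⟨N, hN⟩ := hB a a' h _ _ rfl rfl
    exact hX.gromovProd_le_of_near
      ⟨N, fun n hn k hk => (hN n hn k hk).trans (hB' _ _ _)⟩ (hm a.1 a.2).2.2 (hm a'.1 a'.2).2.2
      (hm a.1 a.2).2.1 (hm a'.1 a'.2).2.1
  have hpow : ∀ i, (g i ^ m)⁻¹ = γ i false ^ m := fun i => by simp [γ]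
  refine ⟨fun i => g i ^ m, fun i => pow_mem (hgG i) m, fun i => (hm i true).1,
    fun i j => ?_, fun i j h => ?_, fun i j h => ?_⟩
  · rw [hpow]; exact key (i, false) (j, true) (by simp)
  · exact key (i, true) (j, true) (by simpa using h)
  · rw [hpow, hpow]; exact key (i, false) (j, false) (by simpa using h)

end Loxodromic

/-! ### Local-to-global principle for chains -/

section Chains

variable {X : Type*} [MetricSpace X] {c : ℝ}

/-- Errors do not accumulate. A small product at one vertex and a long step put all earlier points
in nearly the same direction as the last predecessor, seen from the next vertex; the local bound K
there then gives K + c afresh. -/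
theorem HyperbolicWith.chain_forward (hX : HyperbolicWith X c) {K L : ℝ} (hL : 2 * K + 3 * c < L)
    {n : ℕ} {x : ℕ → X} (h1 : ∀ i, i + 2 ≤ n → gromovProd (x (i + 1)) (x i) (x (i + 2)) ≤ K)
    (h2 : ∀ i, i + 1 ≤ n → L ≤ dist (x i) (x (i + 1))) (i d : ℕ) (hd : i + d + 2 ≤ n) :
    gromovProd (x (i + d + 1)) (x i) (x (i + d + 2)) ≤ K + c := by
  have hc := hX.1
  induction d with
  | zero => linarith [h1 i hd]
  | succ d ih =>
    have h3 := ih (by omega)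
    have h4 := h1 (i + d + 1) (by omega)
    have h5 := h2 (i + d + 1) (by omega)
    have h6 := gromovProd_add_swap (x (i + d + 1)) (x i) (x (i + d + 2))
    refine hX.le_of_lt (x := x (i + d + 1)) h4 ?_
    rw [gromovProd_comm]
    show _ < gromovProd (x (i + d + 2)) _ _
    linarith [show dist (x (i + d + 1)) (x (i + d + 1 + 1)) =
      dist (x (i + d + 1)) (x (i + d + 2)) from rfl]

theorem HyperbolicWith.chain_backward (hX : HyperbolicWith X c) {K L : ℝ} (hL : 2 * K + 3 * c < L)
    {n : ℕ} {x : ℕ → X} (h1 : ∀ i, i + 2 ≤ n → gromovProd (x (i + 1)) (x i) (x (i + 2)) ≤ K)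
    (h2 : ∀ i, i + 1 ≤ n → L ≤ dist (x i) (x (i + 1))) (d : ℕ) :
    ∀ i, i + d + 2 ≤ n → gromovProd (x (i + 1)) (x i) (x (i + d + 2)) ≤ K + c := by
  have hc := hX.1
  induction d with
  | zero => intro i hd; linarith [h1 i hd]
  | succ d ih =>
    intro i hd
    have h3 := ih (i + 1) (by omega)
    have h4 := h1 i (by omega)
    have h5 := h2 (i + 1) (by omega)
    have h6 := gromovProd_add_swap (x (i + 1)) (x (i + 1 + d + 2)) (x (i + 2))
    rw [gromovProd_comm (x (i + 2))] at h6
    rw [gromovProd_comm] at h4 ⊢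
    refine hX.le_of_lt (x := x (i + 2)) h4 ?_
    rw [gromovProd_comm, show i + (d + 1) + 2 = i + 1 + d + 2 by omega]
    linarith [show dist (x (i + 1)) (x (i + 1 + 1)) = dist (x (i + 1)) (x (i + 2)) from rfl,
      show gromovProd (x (i + 2)) (x (i + 1)) (x (i + 1 + d + 2)) ≤ K + c from h3]

/-- Local-to-global principle: a finite chain of points with long steps and small Gromov products
at consecutive triples has small Gromov products at all triples. -/
theorem HyperbolicWith.chain_global (hX : HyperbolicWith X c) {K L : ℝ} (hL : 2 * K + 4 * c < L)
    {n : ℕ} {x : ℕ → X} (h1 : ∀ i, i + 2 ≤ n → gromovProd (x (i + 1)) (x i) (x (i + 2)) ≤ K)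
    (h2 : ∀ i, i + 1 ≤ n → L ≤ dist (x i) (x (i + 1))) {i j k : ℕ} (hij : i < j) (hjk : j < k)
    (hk : k ≤ n) : gromovProd (x j) (x i) (x k) ≤ K + 2 * c := by
  have hc := hX.1
  obtain ⟨d, rfl⟩ : ∃ d, j = i + d + 1 := ⟨j - i - 1, by omega⟩
  have h3 := hX.chain_forward (by linarith) h1 h2 i d (by omega)
  obtain ⟨e, rfl⟩ : ∃ e, k = i + d + 2 + e := ⟨k - (i + d + 2), by omega⟩
  rcases e with _ | e
  · linarith [show gromovProd (x (i + d + 1)) (x i) (x (i + d + 2 + 0)) ≤ K + c from h3]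
  have h4 := hX.chain_backward (by linarith) h1 h2 e (i + d + 1) (by omega)
  have h5 := h2 (i + d + 1) (by omega)
  have h6 := gromovProd_add_swap (x (i + d + 1)) (x (i + d + 2 + (e + 1))) (x (i + d + 2))
  rw [gromovProd_comm (x (i + d + 2))] at h6
  rw [gromovProd_comm] at h3 ⊢
  have h7 := hX.le_of_lt (y := x (i + d + 2 + (e + 1))) h3 ?_
  · linarith
  · rw [gromovProd_comm]
    linarith [show dist (x (i + d + 1)) (x (i + d + 1 + 1)) =
      dist (x (i + d + 1)) (x (i + d + 2)) from rfl,
      show gromovProd (x (i + d + 2)) (x (i + d + 1)) (x (i + d + 2 + (e + 1))) ≤ K + c by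
        rwa [show i + d + 1 + e + 2 = i + d + 2 + (e + 1) by omega] at h4]

end Chains

/-! ### Avoiding words of small total weight -/

section Avoidance

variable {α : Type*}

/-- The word `w_i w_{i+1} … w_{i+l-1}`. -/
def segment (w : ℕ → α) : ℕ → ℕ → List α
  | _, 0 => []
  | i, l + 1 => w i :: segment w (i + 1) l

@[simp]
theorem length_segment (w : ℕ → α) (i l : ℕ) : (segment w i l).length = l := by
  induction l generalizing i with
  | zero => rfl
  | succ l ih => simp [segment, ih]

/-- The potential `∑_v m(v) (2/3)^|v|` of a family `m` of words, counted with multiplicity. -/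
noncomputable def potential (m : List α → ℝ≥0∞) : ℝ≥0∞ := ∑' v, m v * (2 / 3) ^ v.length

/-- The family of the words still to be avoided after the letter `a`: the remainders of the words of
`m` that start with `a`, and the words of `V`. -/
noncomputable def remainder (V : Set (List α)) (m : List α → ℝ≥0∞) (a : α) : List α → ℝ≥0∞ :=
  fun v => m (a :: v) + V.indicator 1 v

theorem tsum_cons_le (f : List α → ℝ≥0∞) : ∑' p : α × List α, f (p.1 :: p.2) ≤ ∑' v, f v :=
  ENNReal.tsum_comp_le_tsum_of_injective
    (f := fun p : α × List α => p.1 :: p.2) (fun p q h => by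
      simp only [List.cons.injEq] at h; exact Prod.ext h.1 h.2) f

/-- Deleting a first letter multiplies a weight by 3/2, and each word passes to at most one letter.
So the first term carries no factor `Fintype.card α`, which is why only one letter can be bad. -/
theorem sum_potential_remainder_le [Fintype α] (V : Set (List α)) (m : List α → ℝ≥0∞) :
    ∑ a, potential (remainder V m a) ≤
      3 / 2 * potential m + Fintype.card α * potential (V.indicator 1) := by
  have h : ∀ a, potential (remainder V m a) =
      ∑' v, m (a :: v) * (2 / 3) ^ v.length + potential (V.indicator 1) := by
    intro a
    simp only [potential, remainder, add_mul, ENNReal.tsum_add]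
  simp only [h, Finset.sum_add_distrib, Finset.sum_const, Finset.card_univ, nsmul_eq_mul]
  gcongr
  rw [← tsum_fintype (L := .unconditional α), ← ENNReal.tsum_prod
    (f := fun a v => m (a :: v) * (2 / 3) ^ v.length)]
  have h32 : (3 / 2 : ℝ≥0∞) * (2 / 3) = 1 := by
    rw [← ENNReal.inv_div (by simp) (by simp)]
    exact ENNReal.inv_mul_cancel (by simp [ENNReal.div_eq_zero_iff]) (by
      simp [ENNReal.div_eq_top])
  have h2 : ∀ p : α × List α, m (p.1 :: p.2) * (2 / 3) ^ p.2.length =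
      3 / 2 * (m (p.1 :: p.2) * (2 / 3) ^ (p.1 :: p.2).length) := by
    intro p
    rw [List.length_cons, pow_succ]
    calc _ = (3 / 2 * (2 / 3)) * (m (p.1 :: p.2) * (2 / 3) ^ p.2.length) := by rw [h32, one_mul]
      _ = _ := by ring
  simp only [h2]
  rw [ENNReal.tsum_mul_left]
  gcongr
  exact tsum_cons_le fun v => m v * (2 / 3) ^ v.length

/-- At most one letter can raise a potential `< 1` to `≥ 1`. -/
theorem subsingleton_bad [Fintype α] {V : Set (List α)}
    (hV : Fintype.card α * potential (V.indicator 1) < 1 / 2) {m : List α → ℝ≥0∞}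
    (hm : potential m < 1) {a b : α} (hab : a ≠ b) (ha : 1 ≤ potential (remainder V m a))
    (hb : 1 ≤ potential (remainder V m b)) : False := by
  classical
  have h1 := sum_potential_remainder_le V m
  have h2 : (2 : ℝ≥0∞) ≤ ∑ a, potential (remainder V m a) := by
    calc (2 : ℝ≥0∞) = 1 + 1 := by norm_num
      _ ≤ ∑ x ∈ {a, b}, potential (remainder V m x) := by
        rw [Finset.sum_pair hab]; gcongr
      _ ≤ _ := Finset.sum_le_sum_of_subset (Finset.subset_univ _)
  have h3 : 3 / 2 * potential m ≤ 3 / 2 := by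
    calc 3 / 2 * potential m ≤ 3 / 2 * 1 := by gcongr
      _ = _ := mul_one _
  have h4 : 3 / 2 * potential m + Fintype.card α * potential (V.indicator 1) < 3 / 2 + 1 / 2 :=
    ENNReal.add_lt_add_of_le_of_lt (ne_top_of_le_ne_top (by simp [ENNReal.div_eq_top]) h3) h3 hV
  have h5 : (3 / 2 + 1 / 2 : ℝ≥0∞) = 2 := by
    rw [ENNReal.div_add_div_same, show (3 : ℝ≥0∞) + 1 = 2 * 2 by norm_num]
    exact ENNReal.mul_div_cancel_right (by simp) (by simp)
  exact absurd (h2.trans h1) (not_le.2 (h4.trans_eq h5))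

/-- At a state of potential `< 1` all letters but one are admissible. -/
theorem exists_good_letters [Fintype α] {M : ℕ} (hM : Fintype.card α = M + 1) {V : Set (List α)}
    (hV : Fintype.card α * potential (V.indicator 1) < 1 / 2) {m : List α → ℝ≥0∞}
    (hm : potential m < 1) :
    ∃ e : Fin M → α, Function.Injective e ∧ ∀ i, potential (remainder V m (e i)) < 1 := by
  classical
  obtain ⟨a₀, ha₀⟩ : ∃ a₀ : α, ∀ a, a ≠ a₀ → potential (remainder V m a) < 1 := by
    by_cases h : ∃ a₀, 1 ≤ potential (remainder V m a₀)
    · obtain ⟨a₀, h⟩ := h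
      exact ⟨a₀, fun a ha => lt_of_not_ge fun h' => subsingleton_bad hV hm ha h' h⟩
    · push Not at h
      have : Nonempty α := Fintype.card_pos_iff.1 (by omega)
      exact ⟨Classical.arbitrary α, fun a _ => h a⟩
  have hcard : Fintype.card {a // a ≠ a₀} = M := by
    simp [Fintype.card_subtype_compl, hM]
  let e := (Fintype.equivFinOfCardEq hcard).symm
  exact ⟨fun i => (e i).1, Subtype.val_injective.comp e.injective, fun i => ha₀ _ (e i).2⟩

/-- A set `V` of words of small total weight is avoided by the branches of a tree all of whose
vertices have one child less than in the full tree. -/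
theorem exists_avoiding_tree [Fintype α] {M : ℕ} (hM : Fintype.card α = M + 1) {V : Set (List α)}
    (hV : Fintype.card α * potential (V.indicator 1) < 1 / 2) :
    ∃ W : (ℕ → Fin M) → ℕ → α, (∀ d i l, segment (W d) i l ∉ V) ∧
      ∀ d d' j, (∀ i < j, d i = d' i) →
        (∀ i < j, W d i = W d' i) ∧ (W d j = W d' j → d j = d' j) := by
  have h0 : potential (V.indicator 1) < 1 := by
    have h1 : (1 : ℝ≥0∞) ≤ Fintype.card α := by rw [hM]; simp
    calc potential (V.indicator 1) ≤ Fintype.card α * potential (V.indicator 1) :=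
          le_mul_of_one_le_left' h1
      _ < 1 / 2 := hV
      _ ≤ 1 := by simp
  choose e hinj hgood using fun m : {m : List α → ℝ≥0∞ // potential m < 1} =>
    exists_good_letters hM hV m.2
  -- The state after j letters is the family of continuations that would complete a forbidden word;
  -- its potential stays below 1.
  let st : (ℕ → Fin M) → ℕ → {m : List α → ℝ≥0∞ // potential m < 1} := fun d j =>
    Nat.rec ⟨V.indicator 1, h0⟩ (fun j m => ⟨remainder V m.1 (e m (d j)), hgood m (d j)⟩) j
  have hst : ∀ d j, (st d (j + 1)).1 = remainder V (st d j).1 (e (st d j) (d j)) := fun _ _ => rfl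
  let W : (ℕ → Fin M) → ℕ → α := fun d j => e (st d j) (d j)
  have hstV : ∀ d j v, v ∈ V → 1 ≤ (st d j).1 v := by
    intro d j v hv
    have h1 : (1 : ℝ≥0∞) ≤ V.indicator 1 v := by simp [hv]
    cases j with
    | zero => exact h1
    | succ j => rw [hst]; exact h1.trans le_add_self
  have hseg : ∀ d l i v, 1 ≤ (st d i).1 (segment (W d) i l ++ v) → 1 ≤ (st d (i + l)).1 v := by
    intro d l
    induction l with
    | zero => intro i v h; exact h
    | succ l ih =>
      intro i v h
      rw [show i + (l + 1) = i + 1 + l by omega]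
      refine ih (i + 1) v ?_
      rw [hst]
      exact le_trans h le_self_add
  refine ⟨W, fun d i l hV => ?_, fun d d' j h => ?_⟩
  -- A completed forbidden word puts the empty word into the state, and the empty word alone has
  -- weight 1.
  · have h1 := hseg d l i [] (by rw [List.append_nil]; exact hstV d i _ hV)
    have h2 : (st d (i + l)).1 [] ≤ potential (st d (i + l)).1 := by
      refine le_trans ?_ (ENNReal.le_tsum [])
      simp
    exact absurd (h1.trans h2) (not_le.2 (st d (i + l)).2)
  · have hs : ∀ i ≤ j, st d i = st d' i := by
      intro i hi
      induction i with
      | zero => rfl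
      | succ i ih =>
        refine Subtype.ext ?_
        rw [hst, hst, ih (by omega), h i (by omega)]
    refine ⟨fun i hi => ?_, fun hW => ?_⟩
    · show e (st d i) (d i) = e (st d' i) (d' i)
      rw [hs i hi.le, h i hi]
    · have : e (st d j) (d j) = e (st d' j) (d' j) := hW
      rw [hs j le_rfl] at this
      exact hinj _ this

end Avoidance

/-! ### Quasi-geodesics that join a ray -/

section Tracking

variable {X : Type*} [MetricSpace X] {c : ℝ}

/-- `P` lies within about `C` of the ray from `o` in the direction of the sequence `x`. -/
def Tracks (o : X) (x : ℕ → X) (C : ℝ) (P : X) : Prop :=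
  ∃ N, ∀ n ≥ N, gromovProd P o (x n) ≤ C

theorem dist_add_one_le_of_chain {z : ℕ → X} {κ L : ℝ}
    (hz : ∀ i j k, i ≤ j → j ≤ k → gromovProd (z j) (z i) (z k) ≤ κ) (hL : 2 * κ + 1 ≤ L)
    (hstep : ∀ j, L ≤ dist (z j) (z (j + 1))) {i j : ℕ} (hij : i ≤ j) :
    dist (z i) (z j) + 1 ≤ dist (z i) (z (j + 1)) := by
  have h1 := hz i j (j + 1) hij (Nat.le_succ j)
  have h2 := hstep j
  simp only [gromovProd] at h1
  rw [dist_comm (z (j + 1)) (z j)] at h1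
  linarith

theorem natCast_le_dist_of_chain {z : ℕ → X} {κ L : ℝ}
    (hz : ∀ i j k, i ≤ j → j ≤ k → gromovProd (z j) (z i) (z k) ≤ κ) (hL : 2 * κ + 1 ≤ L)
    (hstep : ∀ j, L ≤ dist (z j) (z (j + 1))) (j : ℕ) : (j : ℝ) ≤ dist (z 0) (z j) := by
  induction j with
  | zero => simp
  | succ j ih =>
    push_cast
    linarith [dist_add_one_le_of_chain hz hL hstep (Nat.zero_le j)]

/-- A quasi-geodesic from `z_0` that stays close to `x` for a time longer than `d(o, z_0)` tracks,
from some index on, the rays from `o` in the direction of `x`. -/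
theorem HyperbolicWith.exists_tracks (hX : HyperbolicWith X c) {o : X} {x z : ℕ → X}
    {κ ℓ L T : ℝ} (hx : ProdTendsto o x x)
    (hz : ∀ i j k, i ≤ j → j ≤ k → gromovProd (z j) (z i) (z k) ≤ κ) (hκ : 0 ≤ κ)
    (hL : 3 * κ + 7 * c + 1 ≤ L) (hstep : ∀ j, L ≤ dist (z j) (z (j + 1)))
    (hstep' : ∀ j, dist (z j) (z (j + 1)) ≤ ℓ) (hT : ℓ ≤ T)
    (h : ∃ N, ∀ n ≥ N, ∀ m ≥ N, dist o (z 0) + T < gromovProd (z 0) (x n) (z m)) :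
    ∃ i u, dist (z 0) (z i) ≤ u + ℓ ∧ dist o (z i) ≤ dist o (z 0) - u + (ℓ + 2 * κ + 4 * c) ∧
      ∀ j ≥ i, dist (z 0) (z j) ≤ dist o (z 0) + T → Tracks o x (2 * κ + 4 * c) (z j) ∧
        (dist (z 0) (z (j + 1)) ≤ dist o (z 0) + T →
          gromovProd (z j) o (z (j + 1)) ≤ 2 * κ + 5 * c) := by
  classical
  have hc := hX.1
  have hℓ : 0 ≤ ℓ := dist_nonneg.trans (hstep' 0)
  have hgrow := natCast_le_dist_of_chain hz (by linarith) hstep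
  have hmono : Monotone fun j => dist (z 0) (z j) := monotone_nat_of_le_succ fun j => by
    linarith [dist_add_one_le_of_chain hz (by linarith) hstep (Nat.zero_le j)]
  obtain ⟨N, hN⟩ := h
  -- Up to time d(o, z_0) + T the chain stays near the rays from z_0 in the direction of x.
  have hA : ∀ n ≥ N, ∀ j, dist (z 0) (z j) ≤ dist o (z 0) + T →
      gromovProd (z j) (z 0) (x n) ≤ κ + c := by
    intro n hn j hj
    have h1 := hN n hn (max N j) (le_max_left _ _)
    have h2 := hz 0 j (max N j) (Nat.zero_le _) (le_max_right _ _)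
    have h3 := gromovProd_add_swap (z 0) (z (max N j)) (z j)
    rw [gromovProd_comm (z j) (z (max N j))] at h3
    have h4 := hX.le_of_le (t := dist (z 0) (z j) - κ) (by linarith) (by linarith :
      _ ≤ gromovProd (z 0) (z (max N j)) (z j))
    have h5 := gromovProd_add_swap (z 0) (x n) (z j)
    rw [gromovProd_comm (z j)] at h5
    linarith
  obtain ⟨N', hN'⟩ := hx.base (z 0) (dist o (z 0) + 1)
  set n₁ := max N N' with hn₁
  -- Up to c, this is the distance from z_0 at which its ray towards x merges with the ray from o.
  set u := gromovProd (z 0) o (x n₁) with hu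
  have hu_le : u ≤ dist o (z 0) := by
    rw [dist_comm]; exact gromovProd_le_dist_left _ _ _
  have hu' : ∀ n ≥ n₁, gromovProd (z 0) o (x n) ≤ u + c := by
    intro n hn
    have h1 := hX.min_le (z 0) o (x n) (x n₁)
    have h2 := hN' n (le_of_max_le_right hn) n₁ (le_max_right _ _)
    have h3 : gromovProd (z 0) o (x n) ≤ dist o (z 0) := by
      rw [dist_comm]; exact gromovProd_le_dist_left _ _ _
    rcases min_le_iff.1 h1 with h4 | h4 <;> linarith
  -- The index sought is the first one past the merging point.
  have hex : ∃ i, u ≤ dist (z 0) (z i) := by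
    obtain ⟨i, hi⟩ := exists_nat_ge u
    exact ⟨i, hi.trans (hgrow i)⟩
  have hi1 : dist (z 0) (z (Nat.find hex)) ≤ u + ℓ := by
    rcases hfind : Nat.find hex with _ | k
    · rw [dist_self]
      have := gromovProd_nonneg (z 0) o (x n₁)
      linarith
    · have h1 := Nat.find_min hex (m := k) (by omega)
      have h2 := dist_triangle (z 0) (z k) (z (k + 1))
      have h3 := hstep' k
      linarith
  have hi2 := Nat.find_spec hex
  have hB : ∀ n ≥ n₁, ∀ j ≥ Nat.find hex, dist (z 0) (z j) ≤ dist o (z 0) + T →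
      gromovProd (z j) o (x n) ≤ 2 * κ + 4 * c := by
    intro n hn j hj hjT
    have h1 := hA n (le_of_max_le_left hn) j hjT
    have h2 := hu' n hn
    have h3 := hi2.trans (hmono hj)
    have h4 := hX.four_point o (z 0) (z j) (x n)
    simp only [gromovProd] at h1 h2 h3 ⊢
    rw [dist_comm (x n) (z 0)] at h2
    rw [dist_comm (x n) (z j)] at h1 ⊢
    rcases max_cases (dist o (z 0) + dist (z j) (x n)) (dist (z 0) (z j) + dist o (x n)) with
      h5 | h5 <;> rw [h5.1] at h4 <;> linarith
  refine ⟨Nat.find hex, u, hi1, ?_, fun j hj hjT =>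
    ⟨⟨n₁, fun n hn => hB n hn j hj hjT⟩, fun hjT' => ?_⟩⟩
  · have h1 := hA n₁ (le_max_left _ _) (Nat.find hex) (by linarith)
    have h4 := hX.four_point o (z 0) (z (Nat.find hex)) (x n₁)
    simp only [gromovProd] at h1 hu
    rw [dist_comm (x n₁) (z 0)] at hu
    rw [dist_comm (x n₁) (z (Nat.find hex))] at h1
    rcases max_cases (dist o (z 0) + dist (z (Nat.find hex)) (x n₁))
      (dist (z 0) (z (Nat.find hex)) + dist o (x n₁)) with
      h5 | h5 <;> rw [h5.1] at h4 <;> linarith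
  -- Seen from z_j, both x and z_{j+1} lie ahead with product at least L - κ - 2c > 2κ + 5c, so the
  -- bound for x passes to z_{j+1} at the cost of c. The hypothesis on L is what this needs.
  · have h1 := hA n₁ (le_max_left _ _) (j + 1) hjT'
    have h2 := hz 0 j (j + 1) (Nat.zero_le j) (Nat.le_succ j)
    have h3 := gromovProd_add_swap (z j) (z 0) (z (j + 1))
    have h4 := hstep j
    have h5 := hX.le_of_lt (y := z j) h1 (by linarith)
    have h6 := gromovProd_add_swap (z j) (x n₁) (z (j + 1))
    have h7 := hB n₁ le_rfl j hj hjT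
    rw [gromovProd_comm] at h5 h7 ⊢
    have := hX.le_of_lt (y := z (j + 1)) h7 (by linarith)
    linarith

end Tracking

/-! ### Schottky words and forbidden segments -/

section Coding

variable {X : Type*} [MetricSpace X] {c : ℝ} {o : X} {α : Type*}

/-- A family of isometries whose products behave like reduced words in a free group: the Gromov
products at the junctions are at most `K`, the isometries displace `o` by a large distance which is
at most `ℓ`, and they move `o` in well separated directions. -/
structure IsSchottkyFamily (o : X) (φ : α → X ≃ᵢ X) (c K ℓ : ℝ) : Prop where
  junction : ∀ a a', gromovProd o ((φ a)⁻¹ o) (φ a' o) ≤ K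
  long : ∀ a, 4 * K + 18 * c + 1 ≤ dist o (φ a o)
  short : ∀ a, dist o (φ a o) ≤ ℓ
  separated : ∀ a a', a ≠ a' → gromovProd o (φ a o) (φ a' o) ≤
    min (dist o (φ a o)) (dist o (φ a' o)) - (2 * K + 10 * c + 1)

/-- The partial products of a word. -/
def walk (φ : α → X ≃ᵢ X) (w : ℕ → α) : ℕ → X ≃ᵢ X
  | 0 => 1
  | j + 1 => walk φ w j * φ (w j)

variable {φ : α → X ≃ᵢ X} {K ℓ : ℝ} {w : ℕ → α}

theorem walk_mem {G : Subgroup (X ≃ᵢ X)} (hφ : ∀ a, φ a ∈ G) (w : ℕ → α) (j : ℕ) :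
    walk φ w j ∈ G := by
  induction j with
  | zero => exact one_mem G
  | succ j ih => exact mul_mem ih (hφ _)

theorem walk_congr {w w' : ℕ → α} {j : ℕ} (h : ∀ i < j, w i = w' i) :
    walk φ w j = walk φ w' j := by
  induction j with
  | zero => rfl
  | succ j ih => rw [walk, walk, ih fun i hi => h i (by omega), h j (by omega)]

theorem dist_walk_succ (w : ℕ → α) (j : ℕ) :
    dist (walk φ w j o) (walk φ w (j + 1) o) = dist o (φ (w j) o) := by
  rw [walk, IsometryEquiv.mul_apply, IsometryEquiv.dist_eq]

theorem gromovProd_walk_succ (w : ℕ → α) (j : ℕ) :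
    gromovProd (walk φ w (j + 1) o) (walk φ w j o) (walk φ w (j + 2) o) =
      gromovProd o ((φ (w j))⁻¹ o) (φ (w (j + 1)) o) := by
  rw [← gromovProd_isometryEquiv (walk φ w (j + 1)) o]
  congr 1
  rw [← IsometryEquiv.mul_apply, walk, mul_assoc, mul_inv_cancel, mul_one]

namespace IsSchottkyFamily

theorem K_nonneg (hφ : IsSchottkyFamily o φ c K ℓ) (a : α) : 0 ≤ K :=
  (gromovProd_nonneg _ _ _).trans (hφ.junction a a)

theorem ell_pos (hφ : IsSchottkyFamily o φ c K ℓ) (hX : HyperbolicWith X c) (a : α) : 0 < ℓ := by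
  have := hX.1
  have := hφ.K_nonneg a
  linarith [hφ.long a, hφ.short a]

theorem gromovProd_walk_le (hφ : IsSchottkyFamily o φ c K ℓ) (hX : HyperbolicWith X c)
    (w : ℕ → α) {i j k : ℕ} (hij : i ≤ j) (hjk : j ≤ k) :
    gromovProd (walk φ w j o) (walk φ w i o) (walk φ w k o) ≤ K + 2 * c := by
  have hc := hX.1
  have hK := hφ.K_nonneg (w 0)
  have h0 : ∀ x y : X, gromovProd x x y = 0 := fun x y => by
    simp [gromovProd, dist_comm]
  rcases hij.eq_or_lt with rfl | hij
  · rw [h0]; linarith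
  rcases hjk.eq_or_lt with rfl | hjk
  · rw [gromovProd_comm, h0]; linarith
  refine hX.chain_global (L := 4 * K + 18 * c + 1) (n := k) (x := fun j => walk φ w j o)
    (by linarith) (fun i _ => ?_) (fun i _ => ?_) hij hjk le_rfl
  · exact (gromovProd_walk_succ w i).trans_le (hφ.junction _ _)
  · exact (hφ.long _).trans_eq (dist_walk_succ w i).symm

theorem natCast_le_dist_walk (hφ : IsSchottkyFamily o φ c K ℓ) (hX : HyperbolicWith X c)
    (w : ℕ → α) (j : ℕ) : (j : ℝ) ≤ dist o (walk φ w j o) := by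
  have hc := hX.1
  have hK := hφ.K_nonneg (w 0)
  have h := natCast_le_dist_of_chain (z := fun j => walk φ w j o) (κ := K + 2 * c)
    (L := 4 * K + 18 * c + 1) (fun i j k hij hjk => hφ.gromovProd_walk_le hX w hij hjk)
    (by linarith) (fun j => (hφ.long _).trans_eq (dist_walk_succ w j).symm) j
  exact h

theorem dist_walk_le (hφ : IsSchottkyFamily o φ c K ℓ) (w : ℕ → α) (i k : ℕ) :
    dist (walk φ w i o) (walk φ w (i + k) o) ≤ k * ℓ := by
  induction k with
  | zero => simp
  | succ k ih =>
    have h1 := dist_triangle (walk φ w i o) (walk φ w (i + k) o) (walk φ w (i + k + 1) o)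
    have h2 := (dist_walk_succ w (i + k)).trans_le (hφ.short _)
    push_cast
    rw [← add_assoc]
    linarith

theorem isGromovSeq_walk (hφ : IsSchottkyFamily o φ c K ℓ) (hX : HyperbolicWith X c)
    (w : ℕ → α) : IsGromovSeq o fun j => walk φ w j o := by
  refine (tendsto_pair_iff o (fun j => walk φ w j o) (fun j => walk φ w j o)).2 fun t => ?_
  obtain ⟨N, hN⟩ := exists_nat_ge (t + (K + 2 * c))
  have key : ∀ n m, N ≤ n → n ≤ m → t ≤ gromovProd o (walk φ w n o) (walk φ w m o) := by
    intro n m hn hm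
    have h1 := hφ.gromovProd_walk_le hX w (Nat.zero_le n) hm
    have h2 := gromovProd_add_swap o (walk φ w m o) (walk φ w n o)
    rw [gromovProd_comm, gromovProd_comm (walk φ w n o)] at h2
    have h3 := hφ.natCast_le_dist_walk hX w n
    have h4 : (N : ℝ) ≤ n := by exact_mod_cast hn
    have h5 : gromovProd (walk φ w n o) o (walk φ w m o) ≤ K + 2 * c := h1
    linarith
  refine ⟨N, fun n hn m hm => ?_⟩
  rcases le_total n m with h | h
  · exact key n m hn h
  · rw [gromovProd_comm]; exact key m n hm h

end IsSchottkyFamily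

/-- The word `v` leads from `h (o)` along the ray from `o` in the direction of `x`. -/
def Follows (o : X) (x : ℕ → X) (C C' : ℝ) (φ : α → X ≃ᵢ X) : (X ≃ᵢ X) → List α → Prop
  | h, [] => Tracks o x C (h o)
  | h, a :: v => Tracks o x C (h o) ∧ gromovProd (h o) o ((h * φ a) o) ≤ C' ∧
      Follows o x C C' φ (h * φ a) v

variable {x : ℕ → X} {C C' : ℝ}

theorem Follows.tracks {h : X ≃ᵢ X} {v : List α} (hv : Follows o x C C' φ h v) :
    Tracks o x C (h o) := by
  cases v with
  | nil => exact hv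
  | cons a v => exact hv.1

theorem follows_segment (g : X ≃ᵢ X) (w : ℕ → α) (k : ℕ) : ∀ i,
    (∀ j, i ≤ j → j ≤ i + k → Tracks o x C ((g * walk φ w j) o)) →
    (∀ j, i ≤ j → j < i + k → gromovProd ((g * walk φ w j) o) o ((g * walk φ w (j + 1)) o) ≤ C') →
    Follows o x C C' φ (g * walk φ w i) (segment w i k) := by
  induction k with
  | zero => exact fun i h _ => h i le_rfl le_rfl
  | succ k ih =>
    refine fun i h h' => ⟨h i le_rfl (by omega), ?_, ?_⟩
    · rw [mul_assoc]
      exact h' i le_rfl (by omega)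
    · rw [mul_assoc]
      exact ih (i + 1) (fun j hj hj' => h j (by omega) (by omega))
        (fun j hj hj' => h' j (by omega) (by omega))

/-- The letter along a ray is determined by the starting point. -/
theorem IsSchottkyFamily.eq_of_tracks (hφ : IsSchottkyFamily o φ c K ℓ)
    (hX : HyperbolicWith X c) {h : X ≃ᵢ X} {a a' : α}
    (h1 : Tracks o x (2 * K + 8 * c) ((h * φ a) o))
    (h2 : gromovProd (h o) o ((h * φ a) o) ≤ 2 * K + 9 * c)
    (h1' : Tracks o x (2 * K + 8 * c) ((h * φ a') o))
    (h2' : gromovProd (h o) o ((h * φ a') o) ≤ 2 * K + 9 * c) : a = a' := by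
  have hc := hX.1
  have hK := hφ.K_nonneg a
  by_contra hne
  obtain ⟨N, hN⟩ := h1
  obtain ⟨N', hN'⟩ := h1'
  -- Seen from h o, a next point that lies ahead on the ray points in the direction of x; two such
  -- points point in the same direction.
  have key : ∀ a, gromovProd (h o) o ((h * φ a) o) ≤ 2 * K + 9 * c →
      gromovProd ((h * φ a) o) o (x (max N N')) ≤ 2 * K + 8 * c →
      dist o (φ a o) - (2 * K + 9 * c) ≤ gromovProd (h o) (x (max N N')) ((h * φ a) o) := by
    intro a e1 e2
    have e3 := gromovProd_add_swap (h o) o ((h * φ a) o)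
    have e4 : dist (h o) ((h * φ a) o) = dist o (φ a o) := h.dist_eq _ _
    have e5 := hφ.long a
    -- Requires 2K + 9c < d(o, φ a o) - (2K + 9c), which is the reason for the constant in `long`.
    have e6 := hX.le_of_lt (y := h o) e2 (by linarith)
    have e7 := gromovProd_add_swap (h o) (x (max N N')) ((h * φ a) o)
    rw [gromovProd_comm] at e6
    linarith
  have e1 := key a h2 (hN _ (le_max_left _ _))
  have e2 := key a' h2' (hN' _ (le_max_right _ _))
  rw [gromovProd_comm] at e1
  have e3 := hX.le_of_le (t := min (dist o (φ a o)) (dist o (φ a' o)) - (2 * K + 9 * c))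
    (by linarith [min_le_left (dist o (φ a o)) (dist o (φ a' o))] :
      _ ≤ gromovProd (h o) ((h * φ a) o) (x (max N N')))
    (by linarith [min_le_right (dist o (φ a o)) (dist o (φ a' o))] :
      _ ≤ gromovProd (h o) (x (max N N')) ((h * φ a') o))
  -- The common product is at least the minimal displacement minus 2K + 10c; `separated` falls short
  -- of this by 1.
  have e4 := hφ.separated a a' hne
  rw [← gromovProd_isometryEquiv h] at e4
  simp only [IsometryEquiv.mul_apply] at e3
  linarith

/-- Letters along a ray are forced one at a time. Counting forbidden words thus reduces to counting
orbit points near the ray. -/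
theorem IsSchottkyFamily.follows_unique (hφ : IsSchottkyFamily o φ c K ℓ)
    (hX : HyperbolicWith X c) : ∀ (v v' : List α) (h : X ≃ᵢ X),
      Follows o x (2 * K + 8 * c) (2 * K + 9 * c) φ h v →
      Follows o x (2 * K + 8 * c) (2 * K + 9 * c) φ h v' → v.length = v'.length → v = v'
  | [], [], _, _, _, _ => rfl
  | [], _ :: _, _, _, _, hl => by simp at hl
  | _ :: _, [], _, _, _, hl => by simp at hl
  | a :: v, a' :: v', h, hv, hv', hl => by
    have ha : a = a' := hφ.eq_of_tracks hX hv.2.2.tracks hv.2.1 hv'.2.2.tracks hv'.2.1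
    subst ha
    rw [hφ.follows_unique hX v v' (h * φ a) hv.2.2 hv'.2.2 (by simpa using hl)]

/-- The words that follow the ray in the direction of `x` from an orbit point `h (o)` for a time
longer than `d(o, h (o))`. -/
def forbidden (o : X) (x : ℕ → X) (c K ℓ : ℝ) (φ : α → X ≃ᵢ X) (G : Subgroup (X ≃ᵢ X)) (t : ℕ) :
    Set (List α) :=
  {v | ∃ h ∈ G, Follows o x (2 * K + 8 * c) (2 * K + 9 * c) φ h v ∧
    v.length = ⌈dist o (h o) / ℓ⌉₊ + t}

/-- If the isometry `g` maps the direction `x` too close to the direction of a word, then the word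
contains a forbidden segment. -/
theorem IsSchottkyFamily.exists_forbidden (hφ : IsSchottkyFamily o φ c K ℓ)
    (hX : HyperbolicWith X c) {G : Subgroup (X ≃ᵢ X)} (hφG : ∀ a, φ a ∈ G) {t : ℕ}
    (hx : ProdTendsto o x x) {g : X ≃ᵢ X} (hg : g ∈ G) (w : ℕ → α)
    (h : ∃ N, ∀ n ≥ N, ∀ m ≥ N,
      dist o (g o) + ((t + 3) * ℓ + 2 * K + 8 * c) < gromovProd o (g (x n)) (walk φ w m o)) :
    ∃ i k, segment w i k ∈ forbidden o x c K ℓ φ G t := by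
  have hc := hX.1
  have hK := hφ.K_nonneg (w 0)
  have hℓ := hφ.ell_pos hX (w 0)
  have hdist : ∀ a a' : X, dist (g⁻¹ a) (g⁻¹ a') = dist a a' := fun a a' => g⁻¹.dist_eq a a'
  have hgg : ∀ a, g⁻¹ (g a) = a := g.symm_apply_apply
  have h0 : dist o (g⁻¹ o) = dist o (g o) := by
    rw [← hdist o (g o), hgg, dist_comm]
  -- Translation by g⁻¹ keeps the direction x fixed and moves the start of the walk to g⁻¹ o.
  set z : ℕ → X := fun j => (g⁻¹ * walk φ w j) o with hz
  have hz0 : z 0 = g⁻¹ o := rfl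
  have hzz : ∀ i j, dist (z i) (z j) = dist (walk φ w i o) (walk φ w j o) := fun i j => hdist _ _
  have htℓ : 0 ≤ (t : ℝ) * ℓ := by positivity
  -- In T, one ℓ pays for the overshoot past u, ℓ + 2K + 8c for the error in d(o, z_i), one ℓ for
  -- rounding up and tℓ for the t extra letters.
  obtain ⟨i, u, h1, h2, h3⟩ := hX.exists_tracks (κ := K + 2 * c) (ℓ := ℓ)
    (L := 4 * K + 18 * c + 1) (T := (t + 3) * ℓ + 2 * K + 8 * c) (z := z) hx
    (fun i j k hij hjk => (gromovProd_isometryEquiv g⁻¹ _ _ _).trans_le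
      (hφ.gromovProd_walk_le hX w hij hjk)) (by linarith) (by linarith)
    (fun j => by rw [hzz, dist_walk_succ]; exact hφ.long _)
    (fun j => by rw [hzz, dist_walk_succ]; exact hφ.short _) (by linarith) (by
      obtain ⟨N, hN⟩ := h
      refine ⟨N, fun n hn m hm => ?_⟩
      have := hN n hn m hm
      rw [← gromovProd_isometryEquiv g⁻¹, hgg] at this
      rw [hz0, h0]
      exact this)
  refine ⟨i, ⌈dist o (z i) / ℓ⌉₊ + t, g⁻¹ * walk φ w i, mul_mem (inv_mem hg) (walk_mem hφG w i),
    ?_, length_segment _ _ _⟩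
  have hrange : ∀ j, j ≤ i + (⌈dist o (z i) / ℓ⌉₊ + t) → i ≤ j →
      dist (z 0) (z j) ≤ dist o (z 0) + ((t + 3) * ℓ + 2 * K + 8 * c) := by
    intro j hj hij
    obtain ⟨k, rfl⟩ := Nat.exists_eq_add_of_le hij
    have e1 := dist_triangle (z 0) (z i) (z (i + k))
    have e2 := (hzz i (i + k)).trans_le (hφ.dist_walk_le w i k)
    have e3 : (k : ℝ) ≤ ⌈dist o (z i) / ℓ⌉₊ + t := by
      exact_mod_cast (by omega : k ≤ ⌈dist o (z i) / ℓ⌉₊ + t)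
    have e4 := (Nat.ceil_lt_add_one (div_nonneg (dist_nonneg (x := o) (y := z i)) hℓ.le)).le
    have e5 : (k : ℝ) * ℓ ≤ dist o (z i) + ℓ + t * ℓ := by
      calc (k : ℝ) * ℓ ≤ (dist o (z i) / ℓ + 1 + t) * ℓ := by gcongr; linarith
        _ = _ := by field_simp
    linarith
  refine follows_segment g⁻¹ w _ i (fun j hij hj => ?_) (fun j hij hj => ?_)
  · have := (h3 j hij (hrange j hj hij)).1
    rwa [show 2 * (K + 2 * c) + 4 * c = 2 * K + 8 * c by ring] at this
  · have := (h3 j hij (hrange j hj.le hij)).2 (hrange (j + 1) (by omega) (by omega))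
    rwa [show 2 * (K + 2 * c) + 5 * c = 2 * K + 9 * c by ring] at this

theorem dist_le_of_tracks (hX : HyperbolicWith X c) {P Q : X} (hP : Tracks o x C P)
    (hQ : Tracks o x C Q) : dist P Q ≤ |dist o P - dist o Q| + 2 * C + 2 * c := by
  obtain ⟨N, hN⟩ := hP
  obtain ⟨M, hM⟩ := hQ
  have e1 := hN (max N M) (le_max_left _ _)
  have e2 := hM (max N M) (le_max_right _ _)
  have s1 := gromovProd_add_swap o (x (max N M)) P
  have s2 := gromovProd_add_swap o (x (max N M)) Q
  rw [gromovProd_comm] at e1 e2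
  rw [gromovProd_comm] at s1
  have e3 := hX.le_of_le (t := min (dist o P) (dist o Q) - C)
    (by linarith [min_le_left (dist o P) (dist o Q)] : _ ≤ gromovProd o P (x (max N M)))
    (by linarith [min_le_right (dist o P) (dist o Q)] : _ ≤ gromovProd o (x (max N M)) Q)
  simp only [gromovProd] at e3
  rw [dist_comm P o, dist_comm Q o] at e3
  rcases min_cases (dist o P) (dist o Q) with h | h <;> rw [h.1] at e3
  · linarith [neg_abs_le (dist o P - dist o Q)]
  · linarith [le_abs_self (dist o P - dist o Q)]

/-- The sum over the group elements that track a given direction, weighted exponentially by their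
length, is finite. -/
theorem tsum_tracks_ne_top (hX : HyperbolicWith X c) {G : Subgroup (X ≃ᵢ X)}
    (hG : IsStronglyDiscrete o G) (hℓ : 0 < ℓ) (x : ℕ → X) (C : ℝ) :
    ∑' h : {h : X ≃ᵢ X // h ∈ G ∧ Tracks o x C (h o)},
      (2 / 3 : ℝ≥0∞) ^ ⌈dist o (h.1 o) / ℓ⌉₊ ≠ ⊤ := by
  set r := max (ℓ + 2 * C + 2 * c) 1
  have hfin := hG r (by positivity)
  set S := {g : X ≃ᵢ X | g ∈ G ∧ dist o (g o) ≤ r}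
  have : Fintype S := hfin.fintype
  rw [← ENNReal.tsum_fiberwise _ fun h : {h : X ≃ᵢ X // h ∈ G ∧ Tracks o x C (h o)} =>
    ⌈dist o (h.1 o) / ℓ⌉₊]
  refine ne_top_of_le_ne_top (b := ∑' k : ℕ, (Fintype.card S : ℝ≥0∞) * (2 / 3) ^ k) ?_ ?_
  · rw [ENNReal.tsum_mul_left, ENNReal.tsum_geometric]
    refine ENNReal.mul_ne_top (by simp) (ENNReal.inv_ne_top.2 ?_)
    have : (2 / 3 : ℝ≥0∞) < 1 := by
      rw [ENNReal.div_lt_iff (by simp) (by simp)]; norm_num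
    exact (tsub_pos_iff_lt.2 this).ne'
  · refine ENNReal.tsum_le_tsum fun k => ?_
    have h1 : ∀ h : (fun h : {h : X ≃ᵢ X // h ∈ G ∧ Tracks o x C (h o)} =>
        ⌈dist o (h.1 o) / ℓ⌉₊) ⁻¹' {k},
        (2 / 3 : ℝ≥0∞) ^ ⌈dist o (h.1.1 o) / ℓ⌉₊ = (2 / 3) ^ k := fun h => by
      rw [show ⌈dist o (h.1.1 o) / ℓ⌉₊ = k from h.2]
    rw [tsum_congr h1]
    rcases isEmpty_or_nonempty ((fun h : {h : X ≃ᵢ X // h ∈ G ∧ Tracks o x C (h o)} =>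
        ⌈dist o (h.1 o) / ℓ⌉₊) ⁻¹' {k}) with hE | ⟨⟨h₀, hh₀⟩⟩
    · simp
    have hlen : ∀ h : X ≃ᵢ X, ⌈dist o (h o) / ℓ⌉₊ = k → dist o (h o) ≤ k * ℓ ∧
        k * ℓ - ℓ ≤ dist o (h o) := by
      rintro h rfl
      have e1 := Nat.le_ceil (dist o (h o) / ℓ)
      have e2 := (Nat.ceil_lt_add_one (div_nonneg (dist_nonneg (x := o) (y := h o)) hℓ.le)).le
      rw [div_le_iff₀ hℓ] at e1
      rw [← sub_le_iff_le_add, le_div_iff₀ hℓ, sub_mul, one_mul] at e2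
      exact ⟨e1, e2⟩
    -- Elements at the same level k differ by right factors from the finite set S, so each level has
    -- at most `Fintype.card S` elements, uniformly in k.
    let F : (fun h : {h : X ≃ᵢ X // h ∈ G ∧ Tracks o x C (h o)} =>
        ⌈dist o (h.1 o) / ℓ⌉₊) ⁻¹' {k} → S := fun h => ⟨h₀.1⁻¹ * h.1.1,
      mul_mem (inv_mem h₀.2.1) h.1.2.1, by
        have e1 : dist o ((h₀.1⁻¹ * h.1.1) o) = dist (h₀.1 o) (h.1.1 o) := by
          rw [← h₀.1.dist_eq o, ← IsometryEquiv.mul_apply h₀.1, mul_inv_cancel_left]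
        have e2 := dist_le_of_tracks hX h₀.2.2 h.1.2.2
        have e3 := hlen h₀.1 hh₀
        have e4 := hlen h.1.1 h.2
        have e5 : |dist o (h₀.1 o) - dist o (h.1.1 o)| ≤ ℓ := by
          rw [abs_le]; constructor <;> linarith
        rw [e1]
        exact le_max_of_le_left (by linarith)⟩
    have hF : Function.Injective F := fun h h' hhh =>
      Subtype.ext (Subtype.ext (mul_left_cancel (Subtype.ext_iff.1 hhh)))
    refine (ENNReal.tsum_comp_le_tsum_of_injective hF fun _ => (2 / 3 : ℝ≥0∞) ^ k).trans_eq ?_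
    rw [tsum_fintype, Finset.sum_const, nsmul_eq_mul, Finset.card_univ]

/-- The starting element h fixes the length of a forbidden word and hence, by `follows_unique`, the
word. The extra t letters give the factor (2/3)^t. -/
theorem IsSchottkyFamily.potential_forbidden_le (hφ : IsSchottkyFamily o φ c K ℓ)
    (hX : HyperbolicWith X c) (x : ℕ → X) (G : Subgroup (X ≃ᵢ X)) (t : ℕ) :
    potential ((forbidden o x c K ℓ φ G t).indicator 1) ≤
      (∑' h : {h : X ≃ᵢ X // h ∈ G ∧ Tracks o x (2 * K + 8 * c) (h o)},
        (2 / 3 : ℝ≥0∞) ^ ⌈dist o (h.1 o) / ℓ⌉₊) * (2 / 3) ^ t := by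
  have h1 : potential ((forbidden o x c K ℓ φ G t).indicator 1) =
      ∑' v : forbidden o x c K ℓ φ G t, (2 / 3 : ℝ≥0∞) ^ v.1.length := by
    rw [tsum_subtype (forbidden o x c K ℓ φ G t) fun v => (2 / 3 : ℝ≥0∞) ^ v.length]
    refine tsum_congr fun v => ?_
    by_cases hv : v ∈ forbidden o x c K ℓ φ G t <;> simp [hv]
  rw [h1, ← ENNReal.tsum_mul_right]
  choose h hG hfol hlen using fun v : forbidden o x c K ℓ φ G t => v.2
  let F : forbidden o x c K ℓ φ G t → {h : X ≃ᵢ X // h ∈ G ∧ Tracks o x (2 * K + 8 * c) (h o)} :=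
    fun v => ⟨h v, hG v, (hfol v).tracks⟩
  have hF : Function.Injective F := fun v v' hvv => by
    have e : h v = h v' := Subtype.ext_iff.1 hvv
    refine Subtype.ext (hφ.follows_unique hX v.1 v'.1 (h v) (hfol v) (e ▸ hfol v') ?_)
    rw [hlen, hlen, e]
  refine le_trans (le_of_eq (tsum_congr fun v => ?_)) (ENNReal.tsum_comp_le_tsum_of_injective hF
    fun h => (2 / 3 : ℝ≥0∞) ^ ⌈dist o (h.1 o) / ℓ⌉₊ * (2 / 3) ^ t)
  rw [hlen, pow_add]

theorem exists_mul_pow_le {S : ℝ≥0∞} (hS : S ≠ ⊤) {ε : ℝ≥0∞} (hε : 0 < ε) :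
    ∃ t : ℕ, S * (2 / 3) ^ t ≤ ε := by
  have h1 : (2 / 3 : ℝ≥0∞) < 1 := by
    rw [ENNReal.div_lt_iff (by simp) (by simp)]; norm_num
  have h2 := ENNReal.Tendsto.const_mul (a := S)
    (ENNReal.tendsto_pow_atTop_nhds_zero_of_lt_one h1) (Or.inr hS)
  rw [mul_zero] at h2
  exact ((h2.eventually_lt_const hε).mono fun _ => le_of_lt).exists

/-- The parameters can be chosen such that the words forbidden by countably many directions have
small total potential. -/
theorem IsSchottkyFamily.exists_small_forbidden [Fintype α] [Nonempty α]
    (hφ : IsSchottkyFamily o φ c K ℓ)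
    (hX : HyperbolicWith X c) {G : Subgroup (X ≃ᵢ X)} (hG : IsStronglyDiscrete o G)
    {ι : Type*} [Countable ι] (x : ι → ℕ → X) : ∃ t : ι → ℕ,
      Fintype.card α *
        potential ((⋃ k, forbidden o (x k) c K ℓ φ G (t k)).indicator 1) < 1 / 2 := by
  have hℓ := hφ.ell_pos hX (Classical.arbitrary α)
  have hcard : (Fintype.card α : ℝ≥0∞) ≠ 0 := by simp
  obtain ⟨ε, hε, hsum⟩ := ENNReal.exists_pos_sum_of_countable
    (ε := 1 / 2 / Fintype.card α) (by simp [ENNReal.div_eq_zero_iff]) ι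
  choose t ht using fun k => exists_mul_pow_le
    (tsum_tracks_ne_top hX hG hℓ (x k) (2 * K + 8 * c)) (ENNReal.coe_pos.2 (hε k))
  refine ⟨t, ?_⟩
  rw [mul_comm, ← ENNReal.lt_div_iff_mul_lt (Or.inl hcard) (Or.inl (by simp))]
  refine lt_of_le_of_lt ?_ hsum
  calc potential ((⋃ k, forbidden o (x k) c K ℓ φ G (t k)).indicator 1)
      ≤ ∑' v, ∑' k, (forbidden o (x k) c K ℓ φ G (t k)).indicator 1 v * (2 / 3) ^ v.length := by
        refine ENNReal.tsum_le_tsum fun v => ?_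
        rw [ENNReal.tsum_mul_right]
        gcongr
        by_cases hv : v ∈ ⋃ k, forbidden o (x k) c K ℓ φ G (t k)
        · obtain ⟨k, hk⟩ := Set.mem_iUnion.1 hv
          refine le_trans ?_ (ENNReal.le_tsum k)
          simp [hk, hv]
        · simp [hv]
    _ = ∑' k, potential ((forbidden o (x k) c K ℓ φ G (t k)).indicator 1) := ENNReal.tsum_comm
    _ ≤ ∑' k, (ε k : ℝ≥0∞) := ENNReal.tsum_le_tsum fun k =>
        (hφ.potential_forbidden_le hX (x k) G (t k)).trans (ht k)

end Coding

/-! ### Coded limit points and their dimension -/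

section LimitPoints

variable {X : Type*} [MetricSpace X] [GromovHyperbolic X] {c : ℝ} {o : X} {α : Type*}
  {φ : α → X ≃ᵢ X} {K ℓ : ℝ}

/-- The boundary point coded by an infinite word. -/
def IsSchottkyFamily.limit (hφ : IsSchottkyFamily o φ c K ℓ) (hX : HyperbolicWith X c)
    (w : ℕ → α) : GromovSeq o :=
  ⟨fun j => walk φ w j o, hφ.isGromovSeq_walk hX w⟩

theorem uniformlyRadialLimitSet_subset (G : Subgroup (X ≃ᵢ X)) :
    uniformlyRadialLimitSet o G ⊆ radialLimitSet o G := by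
  rintro η ⟨g, hg, σ, hσ, h⟩
  exact ⟨g, hg, σ, hσ, h.1⟩

namespace IsSchottkyFamily

theorem limit_mem_uniformlyRadialLimitSet (hφ : IsSchottkyFamily o φ c K ℓ)
    (hX : HyperbolicWith X c) {G : Subgroup (X ≃ᵢ X)} (hφG : ∀ a, φ a ∈ G) (w : ℕ → α) :
    (hφ.limit hX w).toBoundary ∈ uniformlyRadialLimitSet o G := by
  have hc := hX.1
  have hK := hφ.K_nonneg (w 0)
  have hℓ := hφ.ell_pos hX (w 0)
  refine ⟨walk φ w, walk_mem hφG w, max (K + 2 * c) ℓ, lt_max_of_lt_right hℓ,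
    ⟨EReal.tendsto_nhds_top_iff_real.2 fun t => ?_, fun n => ?_⟩, fun n => ?_, rfl⟩
  · obtain ⟨N, hN⟩ := (hφ.limit hX w).prodTendsto o (t + 1 + c)
    refine eventually_atTop.2 ⟨N, fun k hk => lt_of_lt_of_le
      (EReal.coe_lt_coe_iff.2 (lt_add_one t)) (le_pointBoundaryProd fun y hy => ?_)⟩
    obtain ⟨M, hM⟩ := GromovSeq.prodTendsto_of_eq hy o (t + 1 + c)
    refine ⟨max N M, fun n hn => ?_⟩
    have := hX.le_of_le (hM n (le_of_max_le_right hn) (max N M) (le_max_right _ _))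
      (hN (max N M) (le_max_left _ _) k hk)
    exact le_trans (by linarith) this
  · refine pointBoundaryProd_le_of_frequently (Eventually.frequently ?_)
    refine eventually_atTop.2 ⟨n, fun m hm => le_max_of_le_left ?_⟩
    rw [gromovProd_comm]
    exact hφ.gromovProd_walk_le hX w (Nat.zero_le n) hm
  · exact ((dist_walk_succ w n).trans_le (hφ.short _)).trans (le_max_right _ _)

/-- For this ε, a violation by g makes the product of `g ξ` and the coded point exceed d(o, g o) + T
with the T of `exists_forbidden`. -/
theorem limit_mem_badlyApproximable [MetricSpace (GromovBoundary o)] {b : ℝ} (hb : 1 < b)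
    (hD : IsVisualMetric o b) (hφ : IsSchottkyFamily o φ c K ℓ) (hX : HyperbolicWith X c)
    {G : Subgroup (X ≃ᵢ X)} (hφG : ∀ a, φ a ∈ G) {x : GromovSeq o} {t : ℕ} {w : ℕ → α}
    (hw : ∀ i k, segment w i k ∉ forbidden o x.1 c K ℓ φ G t) :
    (hφ.limit hX w).toBoundary ∈ badlyApproximable b G x.toBoundary := by
  obtain ⟨C, hC, hdist⟩ := hD.exists_const hb
  have hb0 : 0 < b := by linarith
  refine ⟨uniformlyRadialLimitSet_subset G (hφ.limit_mem_uniformlyRadialLimitSet hX hφG w),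
    C⁻¹ * b ^ (-((t + 3) * ℓ + 2 * K + 8 * c)), by positivity, fun g hg => ?_⟩
  by_contra hlt
  rw [not_le, mul_assoc, ← Real.rpow_add hb0, ← neg_add, add_comm _ (dist o (g o)),
    ← toBoundary_map] at hlt
  obtain ⟨N, hN⟩ := lt_of_lt_boundaryProd (lt_boundaryProd_of_dist_lt hdist hlt)
  obtain ⟨i, k, hik⟩ := hφ.exists_forbidden hX hφG (x.prodTendsto o) hg w ⟨N, hN⟩
  exact hw i k hik

/-- The common prefix has length at most jℓ, and after it the walks leave in separated directions,
which adds less than one more ℓ; the slack in `separated` absorbs the hyperbolicity errors. -/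
theorem boundaryProd_limit_le (hφ : IsSchottkyFamily o φ c K ℓ) (hX : HyperbolicWith X c)
    {w w' : ℕ → α} {j : ℕ} (h : ∀ i < j, w i = w' i) (hj : w j ≠ w' j) :
    boundaryProd o (hφ.limit hX w).toBoundary (hφ.limit hX w').toBoundary ≤
      (((j + 1) * ℓ : ℝ) : EReal) := by
  have hc := hX.1
  have hK := hφ.K_nonneg (w 0)
  refine boundaryProd_le_of_frequently (Eventually.frequently ?_)
  refine eventually_atTop.2 ⟨(j + 1, j + 1), ?_⟩
  rintro ⟨n, m⟩ ⟨hn, hm⟩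
  have key : ∀ w : ℕ → α, ∀ n ≥ j + 1, dist o (φ (w j) o) - (K + 2 * c) ≤
      gromovProd (walk φ w j o) (walk φ w (j + 1) o) (walk φ w n o) := by
    intro w n hn
    have e1 := hφ.gromovProd_walk_le hX w (Nat.le_succ j) hn
    have e2 := gromovProd_add_swap (walk φ w j o) (walk φ w n o) (walk φ w (j + 1) o)
    rw [dist_walk_succ, gromovProd_comm, gromovProd_comm (walk φ w (j + 1) o)] at e2
    linarith
  have h1 := key w n hn
  have h2 := key w' m hm
  have h3 := hφ.separated _ _ hj
  have h4 : walk φ w' j = walk φ w j := (walk_congr h).symm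
  rw [← gromovProd_isometryEquiv (walk φ w j)] at h3
  simp only [walk, IsometryEquiv.mul_apply, h4] at h1 h2
  have m1 := min_le_left (dist o (φ (w j) o)) (dist o (φ (w' j) o))
  have m2 := min_le_right (dist o (φ (w j) o)) (dist o (φ (w' j) o))
  have h5 := hX.le_of_lt (y := walk φ w n o) h3 (by linarith)
  rw [gromovProd_comm] at h5
  have h6 := hX.le_of_lt (y := walk φ w' m o) h5 (by linarith)
  rw [gromovProd_comm] at h6
  have h7 := gromovProd_le_add_dist o (walk φ w j o) (walk φ w n o) (walk φ w' m o)
  have h8 := hφ.dist_walk_le w 0 j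
  rw [zero_add, show walk φ w 0 o = o from rfl] at h8
  have h9 := hφ.short (w j)
  show gromovProd o (walk φ w n o) (walk φ w' m o) ≤ _
  linarith

/-- A Schottky family of `M + 1` elements gives a family of uniformly radial, badly approximable
points indexed by the infinite words in `M` letters. -/
theorem exists_coding [MetricSpace (GromovBoundary o)] {b : ℝ} (hb : 1 < b)
    (hD : IsVisualMetric o b) [Fintype α] {M : ℕ} (hM : Fintype.card α = M + 1)
    (hφ : IsSchottkyFamily o φ c K ℓ) (hX : HyperbolicWith X c)
    {G : Subgroup (X ≃ᵢ X)} (hG : IsStronglyDiscrete o G) (hφG : ∀ a, φ a ∈ G)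
    {ι : Type*} [Countable ι] (ξ : ι → GromovBoundary o) :
    ∃ η : (ℕ → Fin M) → GromovBoundary o,
      (∀ d, η d ∈ (⋂ k, badlyApproximable b G (ξ k)) ∩ uniformlyRadialLimitSet o G) ∧
      ∀ (d d' : ℕ → Fin M) (j : ℕ), (∀ i < j, d i = d' i) → d j ≠ d' j →
        boundaryProd o (η d) (η d') ≤ (((j + 1) * ℓ : ℝ) : EReal) := by
  have : Nonempty α := Fintype.card_pos_iff.1 (by omega)
  choose x hx using fun k => exists_gromovSeq (ξ k)
  obtain ⟨t, ht⟩ := hφ.exists_small_forbidden hX hG fun k => (x k).1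
  obtain ⟨W, hW, hW'⟩ := exists_avoiding_tree hM ht
  refine ⟨fun d => (hφ.limit hX (W d)).toBoundary, fun d => ⟨Set.mem_iInter.2 fun k => ?_,
    hφ.limit_mem_uniformlyRadialLimitSet hX hφG _⟩, fun d d' j h hj => ?_⟩
  · rw [← hx k]
    exact hφ.limit_mem_badlyApproximable hb hD hX hφG fun i l hil =>
      hW d i l (Set.mem_iUnion.2 ⟨k, hil⟩)
  · exact hφ.boundaryProd_limit_le hX (hW' d d' j h).1 fun hne => hj ((hW' d d' j h).2 hne)

end IsSchottkyFamily

/-- The dimension of a set that contains a separated family of points indexed by the infinite words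
in `M` letters. -/
theorem le_dimH_of_coding [MetricSpace (GromovBoundary o)] {b : ℝ} (hb : 1 < b)
    (hD : IsVisualMetric o b) {M : ℕ} (hM : 1 < M) {s : ℝ≥0} (hs : b ^ ((s : ℝ) * ℓ) ≤ M)
    {η : (ℕ → Fin M) → GromovBoundary o} {E : Set (GromovBoundary o)} (hE : ∀ d, η d ∈ E)
    (hη : ∀ (d d' : ℕ → Fin M) (j : ℕ), (∀ i < j, d i = d' i) → d j ≠ d' j →
        boundaryProd o (η d) (η d') ≤ (((j + 1) * ℓ : ℝ) : EReal)) :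
    (s : ℝ≥0∞) ≤ dimH E := by
  classical
  rcases eq_zero_or_pos s with rfl | hs0
  · simp
  obtain ⟨C, hC, hdist⟩ := hD.exists_const hb
  have hb0 : 0 < b := by linarith
  have hM0 : (0 : ℝ) < M := by positivity
  have : Nonempty (ℕ → Fin M) := ⟨fun _ => ⟨0, by omega⟩⟩
  have hfirst : ∀ d d' : ℕ → Fin M, d ≠ d' → ∃ j, (∀ i < j, d i = d' i) ∧ d j ≠ d' j := by
    intro d d' hne
    have hex := Function.ne_iff.1 hne
    exact ⟨Nat.find hex, fun i hi => not_not.1 (Nat.find_min hex hi), Nat.find_spec hex⟩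
  have hbound : ∀ d d', |Real.ofDigits d - Real.ofDigits d'| ≤
      (b ^ ℓ * C) ^ (s : ℝ) * dist (η d) (η d') ^ (s : ℝ) := by
    intro d d'
    rcases eq_or_ne d d' with rfl | hne
    · rw [sub_self, abs_zero]; positivity
    obtain ⟨j, hj, hj'⟩ := hfirst d d' hne
    refine (Real.abs_ofDigits_sub_ofDigits_le hj).trans ?_
    have h1 := (hdist (η d) (η d') _).2 (hη d d' j hj hj')
    have h2 : b ^ (-(j * ℓ)) ≤ b ^ ℓ * C * dist (η d) (η d') := by
      calc b ^ (-(j * ℓ)) = b ^ ℓ * C * (C⁻¹ * b ^ (-((j + 1) * ℓ))) := by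
            rw [mul_assoc, mul_inv_cancel_left₀ hC.ne', ← Real.rpow_add hb0]
            congr 1; ring
        _ ≤ _ := by gcongr
    rw [← Real.mul_rpow (by positivity) dist_nonneg]
    refine le_trans ?_ (Real.rpow_le_rpow (by positivity) h2 s.coe_nonneg)
    rw [← Real.rpow_mul hb0.le, show -(j * ℓ) * (s : ℝ) = -((s : ℝ) * ℓ * j) by ring,
      Real.rpow_neg hb0.le, Real.rpow_mul hb0.le, Real.rpow_natCast]
    gcongr
  have hinj : Function.Injective η := by
    intro d d' h
    by_contra hne
    obtain ⟨j, hj, hj'⟩ := hfirst d d' hne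
    have h1 := (hdist (η d) (η d') _).2 (hη d d' j hj hj')
    rw [h, dist_self] at h1
    have : 0 < C⁻¹ * b ^ (-((j + 1) * ℓ)) := by positivity
    linarith
  -- Points first differing at position j have images within M^(-j) ≤ b^(-sℓj), the s-th power of
  -- their distance up to a constant: f is s-Hölder on the coded set.
  let f : GromovBoundary o → ℝ := fun p => Real.ofDigits (Function.invFun η p)
  have hf : ∀ d, f (η d) = Real.ofDigits d := fun d => by
    simp only [f, Function.leftInverse_invFun hinj d]
  have hholder : HolderOnWith (Real.toNNReal ((b ^ ℓ * C) ^ (s : ℝ))) s f (Set.range η) := by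
    rintro _ ⟨d, rfl⟩ _ ⟨d', rfl⟩
    rw [hf, hf, edist_dist, edist_dist, Real.dist_eq,
      ENNReal.ofReal_rpow_of_nonneg dist_nonneg s.coe_nonneg, ← ENNReal.ofReal,
      ← ENNReal.ofReal_mul (by positivity)]
    exact ENNReal.ofReal_le_ofReal (hbound d d')
  have himage : Set.Ico (0 : ℝ) 1 ⊆ f '' Set.range η := by
    intro y hy
    have : NeZero M := ⟨by omega⟩
    exact ⟨η (Real.digits y M), ⟨_, rfl⟩, by rw [hf, Real.ofDigits_digits hM hy]⟩
  have h1 : dimH (f '' Set.range η) ≥ 1 := by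
    refine le_trans (le_of_eq ?_) (dimH_mono himage)
    rw [Real.dimH_of_mem_nhds (x := (1 / 2 : ℝ)) (Ico_mem_nhds (by norm_num) (by norm_num))]
    simp
  have h2 := h1.le.trans (hholder.dimH_image_le hs0)
  rw [ENNReal.le_div_iff_mul_le (Or.inl (by simpa using hs0.ne')) (Or.inl (by simp)), one_mul] at h2
  exact h2.trans (dimH_mono (by rintro _ ⟨d, rfl⟩; exact hE d))

end LimitPoints

/-! ### Large Schottky families below the Poincaré exponent -/

section Alphabet

variable {X : Type*} [MetricSpace X] {c : ℝ} {o : X}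

/-- If the Poincaré series diverges at `s'`, then for `s < s'` the annuli of width one contain more
than `P b ^ (s n)` group elements infinitely often. -/
theorem exists_large_annulus {b : ℝ} (hb : 1 < b) {G : Subgroup (X ≃ᵢ X)}
    (hG : IsStronglyDiscrete o G) {s s' : ℝ} (hs : 0 ≤ s) (hss : s < s')
    (hdiv : ¬ Summable fun g : G => b ^ (-(s' * dist o (g.1 o)))) (P : ℝ) (n₀ : ℕ) :
    ∃ n ≥ n₀, ∃ S : Finset (X ≃ᵢ X), (∀ g ∈ S, g ∈ G ∧ (n : ℝ) ≤ dist o (g o) ∧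
      dist o (g o) ≤ n + 1) ∧ P * b ^ (s * n) < S.card := by
  classical
  by_contra! hcon
  have hb0 : 0 < b := by linarith
  have hfin : ∀ n : ℕ, {g : X ≃ᵢ X | g ∈ G ∧ ⌊dist o (g o)⌋₊ = n}.Finite := fun n =>
    (hG (n + 1) (by positivity)).subset fun g hg => ⟨hg.1, by
      have := Nat.lt_floor_add_one (dist o (g o))
      rw [hg.2] at this; exact this.le⟩
  obtain ⟨A, hmem⟩ : ∃ A : ℕ → Finset (X ≃ᵢ X), ∀ n g, g ∈ A n ↔ g ∈ G ∧ ⌊dist o (g o)⌋₊ = n :=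
    ⟨fun n => (hfin n).toFinset, fun n g => (hfin n).mem_toFinset⟩
  -- If all annuli from n₀ on are small, a larger constant covers the finitely many others too, and
  -- the series at s' is dominated by a geometric one of ratio b^(-(s' - s)).
  have hcard : ∃ Q : ℝ, 0 ≤ Q ∧ ∀ n, ((A n).card : ℝ) ≤ Q * b ^ (s * n) := by
    have h2 : (0 : ℝ) ≤ ∑ n ∈ Finset.range n₀, ((A n).card : ℝ) :=
      Finset.sum_nonneg fun _ _ => Nat.cast_nonneg _
    refine ⟨|P| + ∑ n ∈ Finset.range n₀, ((A n).card : ℝ), add_nonneg (abs_nonneg P) h2,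
      fun n => ?_⟩
    have h1 : 1 ≤ b ^ (s * n) := Real.one_le_rpow hb.le (mul_nonneg hs n.cast_nonneg)
    rcases lt_or_ge n n₀ with hn | hn
    · have h3 := Finset.single_le_sum (f := fun n => ((A n).card : ℝ))
        (fun _ _ => Nat.cast_nonneg _) (Finset.mem_range.2 hn)
      have h4 := abs_nonneg P
      calc ((A n).card : ℝ) ≤ (|P| + ∑ n ∈ Finset.range n₀, ((A n).card : ℝ)) * 1 := by
            rw [mul_one]; linarith
        _ ≤ _ := by gcongr
    · refine (hcon n hn (A n) fun g hg => ?_).trans ?_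
      · rw [hmem] at hg
        refine ⟨hg.1, ?_, ?_⟩
        · rw [← hg.2]; exact Nat.floor_le dist_nonneg
        · rw [← hg.2]; exact (Nat.lt_floor_add_one _).le
      · gcongr
        linarith [le_abs_self P]
  obtain ⟨Q, hQ, hcard⟩ := hcard
  refine hdiv ?_
  have htsum : ∑' g : G, ENNReal.ofReal (b ^ (-(s' * dist o (g.1 o)))) ≠ ⊤ := by
    rw [← ENNReal.tsum_fiberwise _ fun g : G => ⌊dist o (g.1 o)⌋₊]
    have hgeo : Summable fun n : ℕ => Q * (b ^ (-(s' - s))) ^ n :=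
      (summable_geometric_of_lt_one (by positivity)
        (Real.rpow_lt_one_of_one_lt_of_neg hb (by linarith))).mul_left Q
    refine ne_top_of_le_ne_top hgeo.tsum_ofReal_ne_top (ENNReal.tsum_le_tsum fun n => ?_)
    let F : ((fun g : G => ⌊dist o (g.1 o)⌋₊) ⁻¹' {n}) → A n := fun g =>
      ⟨g.1.1, (hmem n _).2 ⟨g.1.2, g.2⟩⟩
    have hF : Function.Injective F := fun g g' h =>
      Subtype.ext (Subtype.ext (congrArg (fun a : A n => a.1) h))
    calc ∑' g : ((fun g : G => ⌊dist o (g.1 o)⌋₊) ⁻¹' {n}),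
          ENNReal.ofReal (b ^ (-(s' * dist o (g.1.1 o))))
        ≤ ∑' g : ((fun g : G => ⌊dist o (g.1 o)⌋₊) ⁻¹' {n}), ENNReal.ofReal (b ^ (-(s' * n))) := by
          refine ENNReal.tsum_le_tsum fun g => ENNReal.ofReal_le_ofReal
            (Real.rpow_le_rpow_of_exponent_le hb.le ?_)
          have h1 : (n : ℝ) ≤ dist o (g.1.1 o) := 
            (Nat.le_floor_iff dist_nonneg).1 (show ⌊dist o (g.1.1 o)⌋₊ = n from g.2).ge
          have : s' * n ≤ s' * dist o (g.1.1 o) :=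
            mul_le_mul_of_nonneg_left h1 (by linarith)
          linarith
      _ ≤ ∑' _ : A n, ENNReal.ofReal (b ^ (-(s' * n))) :=
          ENNReal.tsum_comp_le_tsum_of_injective hF fun _ => ENNReal.ofReal (b ^ (-(s' * n)))
      _ = ENNReal.ofReal ((A n).card * b ^ (-(s' * n))) := by
          rw [tsum_fintype, Finset.sum_const, nsmul_eq_mul, Finset.card_univ, Fintype.card_coe,
            ENNReal.ofReal_mul (by positivity), ENNReal.ofReal_natCast]
      _ ≤ _ := by
          refine ENNReal.ofReal_le_ofReal ?_
          calc ((A n).card : ℝ) * b ^ (-(s' * n)) ≤ Q * b ^ (s * n) * b ^ (-(s' * n)) := by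
                gcongr; exact hcard n
            _ = _ := by
                rw [mul_assoc, ← Real.rpow_add hb0, ← Real.rpow_mul_natCast hb0.le]
                congr 2; ring
  refine (ENNReal.summable_toReal htsum).congr fun g => ?_
  exact ENNReal.toReal_ofReal (by positivity)

/-- A finite set of group elements contains a separated subset of proportional size. -/
theorem exists_separated_subset {G : Subgroup (X ≃ᵢ X)} {R : ℝ} (hR₀ : 0 ≤ R)
    {B : Finset (X ≃ᵢ X)}
    (hB : ∀ g ∈ G, dist o (g o) ≤ R → g ∈ B) (S : Finset (X ≃ᵢ X)) (hS : ∀ g ∈ S, g ∈ G) :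
    ∃ S' ⊆ S, (∀ f ∈ S', ∀ f' ∈ S', f ≠ f' → R < dist (f o) (f' o)) ∧
      S.card ≤ S'.card * B.card := by
  classical
  obtain ⟨S', hS', hmax⟩ := (S.powerset.filter fun S' => ∀ f ∈ S', ∀ f' ∈ S', f ≠ f' →
    R < dist (f o) (f' o)).exists_maximal ⟨∅, by simp⟩
  rw [Finset.mem_filter, Finset.mem_powerset] at hS'
  refine ⟨S', hS'.1, hS'.2, ?_⟩
  -- By maximality every element of S is within R of some f ∈ S', hence lies in f B.
  refine (Finset.card_le_card (t := S'.biUnion fun f => B.image fun g => f * g)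
    fun f hf => ?_).trans (Finset.card_biUnion_le_card_mul _ _ _ fun f _ => Finset.card_image_le)
  rw [Finset.mem_biUnion]
  have hnear : ∀ f' ∈ S', dist (f' o) (f o) ≤ R → f ∈ B.image fun g => f' * g := by
    intro f' hf' hd
    refine Finset.mem_image.2 ⟨f'⁻¹ * f, hB _ (mul_mem (inv_mem (hS _ (hS'.1 hf'))) (hS _ hf)) ?_,
      mul_inv_cancel_left _ _⟩
    rwa [← f'.dist_eq, ← IsometryEquiv.mul_apply f', mul_inv_cancel_left]
  by_contra! hcon
  have hfar : ∀ f' ∈ S', R < dist (f' o) (f o) := fun f' hf' =>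
    lt_of_not_ge fun h => hcon f' hf' (hnear f' hf' h)
  have hins : insert f S' ∈ S.powerset.filter fun S' => ∀ f ∈ S', ∀ f' ∈ S', f ≠ f' →
      R < dist (f o) (f' o) := by
    rw [Finset.mem_filter, Finset.mem_powerset]
    refine ⟨Finset.insert_subset hf hS'.1, fun a ha a' ha' hne => ?_⟩
    rcases Finset.mem_insert.1 ha with h | h <;> rcases Finset.mem_insert.1 ha' with h' | h'
    · exact absurd (h.trans h'.symm) hne
    · rw [h, dist_comm]; exact hfar a' h'
    · rw [h']; exact hfar a h
    · exact hS'.2 a h a' h' hne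
  have hf' : f ∈ S' := hmax hins (Finset.subset_insert f S') (Finset.mem_insert_self f S')
  have hR := hfar f hf'
  rw [dist_self] at hR
  linarith

/-- Extending isometries by elements of a Schottky pair on both sides, chosen by the pigeonhole
principle, turns a separated set into a Schottky family. -/
theorem isSchottkyFamily_extend (hX : HyperbolicWith X c) {K L T n : ℝ} (hK : 0 ≤ K)
    (hL : 4 * K + 30 * c + 1 ≤ L) {p q : X ≃ᵢ X} (hp : L ≤ dist o (p o)) (hq : L ≤ dist o (q o))
    (hp' : dist o (p o) ≤ T) (hq' : dist o (q o) ≤ T) (hn : L + 2 * T ≤ n)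
    (hqp : gromovProd o (q⁻¹ o) (p o) ≤ K) {S : Set (X ≃ᵢ X)}
    (hlen : ∀ f ∈ S, n ≤ dist o (f o) ∧ dist o (f o) ≤ n + 1)
    (hpS : ∀ f ∈ S, gromovProd o (p⁻¹ o) (f o) ≤ K + c)
    (hqS : ∀ f ∈ S, gromovProd o (f⁻¹ o) (q o) ≤ K + c)
    (hsep : ∀ f ∈ S, ∀ f' ∈ S, f ≠ f' →
      4 * K + 32 * c + 3 + 6 * T < dist (f o) (f' o)) :
    IsSchottkyFamily o (fun f : S => p * f.1 * q) c (K + 3 * c) (n + 1 + 2 * T) := by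
  have hc := hX.1
  have hinv : ∀ g : X ≃ᵢ X, dist o (g⁻¹ o) = dist o (g o) := fun g => by
    rw [← g.dist_eq o, ← IsometryEquiv.mul_apply, mul_inv_cancel, dist_comm]; rfl
  have hup : ∀ f : X ≃ᵢ X, dist o ((p * f * q) o) ≤ dist o (f o) + 2 * T := by
    intro f
    have e1 := dist_triangle o (p o) (p (f (q o)))
    have e2 := dist_triangle o (f o) (f (q o))
    rw [p.dist_eq] at e1
    rw [f.dist_eq] at e2
    simp only [IsometryEquiv.mul_apply]
    linarith
  have hdown : ∀ f : X ≃ᵢ X, dist o (f o) - 2 * T ≤ dist o ((p * f * q) o) := by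
    intro f
    have e1 := dist_triangle (p o) o (p (f (q o)))
    have e2 := dist_triangle o (f (q o)) (f o)
    rw [p.dist_eq, dist_comm (p o)] at e1
    rw [f.dist_eq, dist_comm (q o)] at e2
    simp only [IsometryEquiv.mul_apply]
    linarith
  refine ⟨fun f f' => ?_, fun f => ?_, fun f => ?_, fun f f' hne => ?_⟩
  -- The junction product of p f q and p f' q is the product at the middle vertex of this six-step
  -- path; the local bound K + c becomes K + 3c.
  · let w : ℕ → X ≃ᵢ X := fun
      | 0 => p
      | 1 => f.1
      | 2 => q
      | 3 => p
      | 4 => f'.1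
      | _ => q
    have h := hX.chain_global (K := K + c) (L := L) (n := 6) (x := fun j => walk id w j o)
      (by linarith) (fun i hi => ?_) (fun i hi => ?_) (i := 0) (j := 3) (k := 6)
      (by norm_num) (by norm_num) le_rfl
    · rw [← gromovProd_isometryEquiv (p * f.1 * q)]
      refine le_trans (le_of_eq ?_) (h.trans_eq (by ring))
      simp only [walk, w, id, one_mul, ← IsometryEquiv.mul_apply, mul_inv_cancel, mul_assoc]
    · refine (gromovProd_walk_succ w i).trans_le ?_
      have : i ≤ 4 := by omega
      interval_cases i
      · exact hpS f.1 f.2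
      · exact hqS f.1 f.2
      · exact hqp.trans (by linarith)
      · exact hpS f'.1 f'.2
      · exact hqS f'.1 f'.2
    · refine le_trans ?_ (dist_walk_succ w i).ge
      have h1 := (hlen f.1 f.2).1
      have h2 := (hlen f'.1 f'.2).1
      have : i ≤ 5 := by omega
      interval_cases i <;> simp only [w, id] <;> linarith
  · linarith [hdown f.1, (hlen f.1 f.2).1]
  · linarith [hup f.1, (hlen f.1 f.2).2]
  -- The displacements of p f q and p f' q differ by at most 1 + 4T, and extension by q costs 2T of
  -- separation; the 6T + 1 in the hypothesis pays for both.
  · have h1 := hsep f.1 f.2 f'.1 f'.2 fun h => hne (Subtype.ext h)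
    have h2 : dist (f.1 o) (f'.1 o) - 2 * T ≤ dist ((p * f.1 * q) o) ((p * f'.1 * q) o) := by
      have e1 := dist_triangle4 (f.1 o) (f.1 (q o)) (f'.1 (q o)) (f'.1 o)
      rw [f.1.dist_eq, f'.1.dist_eq, dist_comm (q o)] at e1
      simp only [IsometryEquiv.mul_apply, p.dist_eq]
      linarith
    have u1 := hup f.1
    have u2 := hup f'.1
    have d1 := hdown f.1
    have d2 := hdown f'.1
    have l1 := hlen f.1 f.2
    have l2 := hlen f'.1 f'.2
    simp only [gromovProd]
    rw [dist_comm _ o, dist_comm _ o]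
    rcases min_cases (dist o ((p * f.1 * q) o)) (dist o ((p * f'.1 * q) o)) with h | h <;>
      rw [h.1] <;> linarith

/-- Below the Poincaré exponent there are Schottky families with as many elements as needed for a
lower bound on the dimension. -/
theorem exists_large_schottkyFamily [GromovHyperbolic X] [MetricSpace (GromovBoundary o)] {b : ℝ}
    (hX : HyperbolicWith X c) (hb : 1 < b) (hD : IsVisualMetric o b) {G : Subgroup (X ≃ᵢ X)}
    (hG : IsStronglyDiscrete o G) (hG' : IsOfGeneralType o G) {s s' : ℝ} (hs : 0 ≤ s)
    (hss : s < s') (hdiv : ¬ Summable fun g : G => b ^ (-(s' * dist o (g.1 o)))) :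
    ∃ (S : Finset (X ≃ᵢ X)) (φ : S → X ≃ᵢ X) (K ℓ : ℝ) (M : ℕ), (∀ a, φ a ∈ G) ∧
      IsSchottkyFamily o φ c K ℓ ∧ S.card = M + 1 ∧ 1 < M ∧ b ^ (s * ℓ) ≤ M := by
  classical
  have hc := hX.1
  have hb0 : 0 < b := by linarith
  obtain ⟨K, hK, h⟩ := exists_schottky_pair hX hb hD hG hG'
  obtain ⟨t, htG, htL, hj, hne, hne'⟩ := h (4 * K + 30 * c + 1)
  obtain ⟨T, htT⟩ := Finite.exists_le fun i => dist o (t i o)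
  have hT0 : 0 ≤ T := dist_nonneg.trans (htT true)
  have hR0 : 0 < 4 * K + 32 * c + 3 + 6 * T := by linarith
  obtain ⟨B, hB⟩ : ∃ B : Finset (X ≃ᵢ X), ∀ g ∈ G,
      dist o (g o) ≤ 4 * K + 32 * c + 3 + 6 * T → g ∈ B :=
    ⟨(hG _ hR0).toFinset, fun g hg hgR => (hG _ hR0).mem_toFinset.2 ⟨hg, hgR⟩⟩
  obtain ⟨n₀, hn₀⟩ := exists_nat_ge (4 * K + 30 * c + 1 + 2 * T)
  -- The factor 4 is for the pigeonhole over pairs of extensions, `B.card` for the separation, and 3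
  -- b^(s(1 + 2T)) for the bound on M. The gap s < s' makes any such factor affordable.
  obtain ⟨n, hn, S, hS, hcard⟩ := exists_large_annulus hb hG hs hss hdiv
    (4 * (3 * b ^ (s * (1 + 2 * T)) * B.card)) n₀
  have hn' : 4 * K + 30 * c + 1 + 2 * T ≤ n := hn₀.trans (by exact_mod_cast hn)
  obtain ⟨ℓ, hℓ⟩ : ∃ ℓ : ℝ, ℓ = n + 1 + 2 * T := ⟨_, rfl⟩
  have hℓ0 : 0 ≤ ℓ := by rw [hℓ]; positivity
  obtain ⟨M, hM⟩ : ∃ M : ℕ, M = ⌈b ^ (s * ℓ)⌉₊ + 1 := ⟨_, rfl⟩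
  have hone : 1 ≤ b ^ (s * ℓ) := Real.one_le_rpow hb.le (mul_nonneg hs hℓ0)
  have hM1 : 1 < M := by
    have : 0 < ⌈b ^ (s * ℓ)⌉₊ := Nat.ceil_pos.2 (by positivity)
    omega
  have hMle : (M : ℝ) ≤ 3 * b ^ (s * ℓ) := by
    have := Nat.ceil_lt_add_one (show 0 ≤ b ^ (s * ℓ) by positivity)
    rw [hM]; push_cast; linarith
  have hcard' : 4 * (M * B.card) < S.card := by
    have : (4 * (M * B.card) : ℝ) < S.card := by
      refine lt_of_le_of_lt ?_ hcard
      calc (4 * (M * B.card) : ℝ) ≤ 4 * (3 * b ^ (s * ℓ) * B.card) := by gcongr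
        _ = _ := by
          rw [hℓ, show s * ((n : ℝ) + 1 + 2 * T) = s * (1 + 2 * T) + s * n by ring,
            Real.rpow_add hb0]
          ring
    exact_mod_cast this
  -- The two directions are apart, so f o cannot be close to both.
  have hi : ∀ f : X ≃ᵢ X, ∃ i, gromovProd o ((t i)⁻¹ o) (f o) ≤ K + c := by
    intro f
    have e1 := hX.min_le o ((t true)⁻¹ o) (f o) ((t false)⁻¹ o)
    have e2 := hne' true false (by simp)
    rcases min_le_iff.1 (e1.trans (by linarith : _ ≤ K + c)) with h | h
    · exact ⟨true, h⟩
    · exact ⟨false, by rwa [gromovProd_comm]⟩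
  have hi' : ∀ f : X ≃ᵢ X, ∃ i, gromovProd o (f⁻¹ o) (t i o) ≤ K + c := by
    intro f
    have e1 := hX.min_le o (t true o) (f⁻¹ o) (t false o)
    have e2 := hne true false (by simp)
    rcases min_le_iff.1 (e1.trans (by linarith : _ ≤ K + c)) with h | h
    · exact ⟨true, by rwa [gromovProd_comm]⟩
    · exact ⟨false, h⟩
  choose i hi using hi
  choose i' hi' using hi'
  obtain ⟨⟨y, y'⟩, -, hy⟩ := Finset.exists_lt_card_fiber_of_mul_lt_card_of_maps_to
    (s := S) (t := (Finset.univ : Finset (Bool × Bool))) (f := fun f => (i f, i' f))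
    (n := M * B.card) (fun _ _ => Finset.mem_univ _) (by simpa using hcard')
  set S₁ := S.filter fun f => (i f, i' f) = (y, y') with hS₁
  have hS₁mem : ∀ f ∈ S₁, f ∈ S ∧ i f = y ∧ i' f = y' := fun f hf => by
    simpa [hS₁] using hf
  obtain ⟨S₂, hS₂, hsep, hcard₂⟩ := exists_separated_subset hR0.le hB S₁
    fun g hg => (hS g (hS₁mem g hg).1).1
  have hM₂ : M + 1 ≤ S₂.card := by
    have := hy.trans_le hcard₂
    exact Nat.lt_of_mul_lt_mul_right this
  obtain ⟨S₃, hS₃, hcard₃⟩ := Finset.exists_subset_card_eq hM₂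
  have hmem : ∀ f ∈ S₃, f ∈ S ∧ i f = y ∧ i' f = y' := fun f hf => hS₁mem f (hS₂ (hS₃ hf))
  refine ⟨S₃, fun f => t y * f.1 * t y', K + 3 * c, ℓ, M, fun f => mul_mem (mul_mem (htG _)
    (hS _ (hmem _ f.2).1).1) (htG _), ?_, hcard₃, hM1, ?_⟩
  · rw [hℓ]
    exact isSchottkyFamily_extend (S := (S₃ : Set (X ≃ᵢ X))) hX hK le_rfl (htL y) (htL y') (htT y)
      (htT y') hn' (hj y' y) (fun f hf => (hS f (hmem f hf).1).2)
      (fun f hf => by rw [← (hmem f hf).2.1]; exact hi f)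
      (fun f hf => by rw [← (hmem f hf).2.2]; exact hi' f)
      (fun f hf f' hf' hne => hsep f (hS₃ hf) f' (hS₃ hf') hne)
  · rw [hM]; push_cast
    linarith [Nat.le_ceil (b ^ (s * ℓ))]

end Alphabet

/-! ### Lower bound, nonemptiness and optimality -/

section Main

variable {X : Type*} [MetricSpace X] [GromovHyperbolic X] {o : X}
  [MetricSpace (GromovBoundary o)] {b : ℝ} {G : Subgroup (X ≃ᵢ X)}

theorem poincareExponent_le_dimH (hb : 1 < b) (hD : IsVisualMetric o b)
    (hG : IsStronglyDiscrete o G) (hG' : IsOfGeneralType o G) {ι : Type*} [Countable ι]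
    (ξ : ι → GromovBoundary o) :
    poincareExponent o b G ≤
      dimH ((⋂ k, badlyApproximable b G (ξ k)) ∩ uniformlyRadialLimitSet o G) := by
  obtain ⟨c, hX⟩ := exists_hyperbolicWith (X := X)
  refine ENNReal.le_of_forall_nnreal_lt fun s hs => ?_
  obtain ⟨s', hss', hs'⟩ := ENNReal.lt_iff_exists_nnreal_btwn.1 hs
  have hdiv : ¬ Summable fun g : G => b ^ (-((s' : ℝ) * dist o (g.1 o))) := fun h =>
    absurd hs' (not_lt.2 (iInf₂_le s' h))
  obtain ⟨S, φ, K, ℓ, M, hφG, hφ, hcard, hM, hsM⟩ := exists_large_schottkyFamily hX hb hD hG hG'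
    s.coe_nonneg (NNReal.coe_lt_coe.2 (ENNReal.coe_lt_coe.1 hss')) hdiv
  obtain ⟨η, hη, hη'⟩ := hφ.exists_coding hb hD (by simpa using hcard) hX hG hφG ξ
  exact le_dimH_of_coding hb hD hM hsM hη hη'

/-- The dimension bound would give a point only for δ > 0. Two Schottky letters suffice instead:
losing one at each step leaves a single branch. -/
theorem badlyApproximable_nonempty (hb : 1 < b) (hD : IsVisualMetric o b)
    (hG : IsStronglyDiscrete o G) (hG' : IsOfGeneralType o G) (ζ : GromovBoundary o) :
    (badlyApproximable b G ζ).Nonempty := by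
  obtain ⟨c, hX⟩ := exists_hyperbolicWith (X := X)
  have hc := hX.1
  obtain ⟨K, hK, h⟩ := exists_schottky_pair hX hb hD hG hG'
  obtain ⟨t, htG, htL, hj, hne, -⟩ := h (4 * K + 18 * c + 1)
  obtain ⟨ℓ, hℓ⟩ := Finite.exists_le fun i => dist o (t i o)
  have hφ : IsSchottkyFamily o t c K ℓ := ⟨hj, htL, hℓ, fun a a' haa => (hne a a' haa).trans (by
    have := le_min (htL a) (htL a')
    linarith)⟩
  obtain ⟨η, hη, -⟩ := hφ.exists_coding hb hD (M := 1) (by simp) hX hG htG fun _ : Unit => ζ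
  exact ⟨η fun _ => 0, Set.mem_iInter.1 (hη fun _ => 0).1 ()⟩

/-- Once φ(b^d(o, g o)) < ε / C, the improved inequality contradicts bad approximability, so its
solutions have bounded displacement and are finitely many. -/
theorem dirichletOptimal_of_nonempty (hb : 1 < b) (hG : IsStronglyDiscrete o G)
    {ζ : GromovBoundary o} (h : (badlyApproximable b G ζ).Nonempty) : DirichletOptimal b G ζ := by
  obtain ⟨η, hη, ε, hε, hBA⟩ := h
  rintro ⟨φ, hφ, hall⟩
  have hb0 : 0 < b := by linarith
  obtain ⟨C, hC, hinf⟩ := hall η hη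
  obtain ⟨t₀, ht₀⟩ := eventually_atTop.1 (hφ.eventually_lt_const (div_pos hε hC))
  obtain ⟨r, hr⟩ := eventually_atTop.1
    ((tendsto_rpow_atTop_of_base_gt_one b hb).eventually_ge_atTop t₀)
  refine hinf ((hG (max r 1) (by positivity)).subset fun g hg => ⟨hg.1, ?_⟩)
  by_contra hlt
  have h1 := ht₀ _ (hr (dist o (g o)) ((le_max_left r 1).trans (not_le.1 hlt).le))
  have h2 := (hBA g hg.1).trans hg.2
  have hpos : 0 < b ^ (-dist o (g o)) := by positivity
  rw [lt_div_iff₀ hC] at h1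
  nlinarith

end Main

end HypDioph

theorem mainTheorem2 {X : Type*} [MetricSpace X] [GromovHyperbolic X] (o : X)
    [MetricSpace (GromovBoundary o)] (b : ℝ) (hb : 1 < b) (hD : IsVisualMetric o b)
    (G : Subgroup (X ≃ᵢ X)) (hG : IsStronglyDiscrete o G) (hG' : IsOfGeneralType o G)
    {ι : Type*} [Countable ι] (ξ : ι → GromovBoundary o) :
    (dimH ((⋂ k, badlyApproximable b G (ξ k)) ∩ uniformlyRadialLimitSet o G) =
        poincareExponent o b G ∧
      poincareExponent o b G = dimH (radialLimitSet o G)) ∧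
    (∀ ζ : GromovBoundary o, (badlyApproximable b G ζ).Nonempty) ∧
    (∀ ζ : GromovBoundary o, DirichletOptimal b G ζ) := by
  have h1 := poincareExponent_le_dimH hb hD hG hG' ξ
  have h2 : dimH ((⋂ k, badlyApproximable b G (ξ k)) ∩ uniformlyRadialLimitSet o G) ≤
      dimH (radialLimitSet o G) :=
    dimH_mono (Set.inter_subset_right.trans (uniformlyRadialLimitSet_subset G))
  have h3 := dimH_radialLimitSet_le hb hD hG
  refine ⟨⟨le_antisymm (h2.trans h3) h1, le_antisymm (h1.trans h2) h3⟩,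
    badlyApproximable_nonempty hb hD hG hG',
    fun ζ => dirichletOptimal_of_nonempty hb hG (badlyApproximable_nonempty hb hD hG hG' ζ)⟩
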